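/- **Setting.** Let $S$ (states) and $A$ (actions) be Borel spaces. For $x\in S$ let $A(x)\subseteq A$ be the set of admissible actions; $K=\{(x,a):a\in A(x)\}$ is a measurable subset of $S\times A$ and contains the graph of a measurable map $S\to A$. Let $q(dy|x,a)$ be a finite signed kernel on $S$ given $(x,a)\in K$ with $q(\Gamma|x,a)\ge 0$ for Borel $\Gamma\not\ni x$, $q(S|x,a)=0$, and, with $q_x(a):=-q(\{x\}|x,a)$, $\bar q_x:=\sup_{a\in A(x)}q_x(a)<\infty$ for every $x$. Adjoin isolated points $x_\infty$ to $S$ and $a_\infty$ to $A$, put $A(x_\infty)=\{a_\infty\}$, and let all rates vanish at $x_\infty$ and off $K$. A sample path is a sequence $\omega=(x_0,\theta_1,x_1,\theta_2,x_2,\dots)$ with $x_0\in S$, which either has all $(\theta_m,x_m)\in(0,\infty)\times S$, or has $(\theta_i,x_i)\in(0,\infty)\times S$ for $1\le i<m$ and $(\theta_i,x_i)=(\infty,x_\infty)$ for $i\ge m$, for some $m\ge1$; $\Omega$ is the set of sample paths. Put $T_0=0$, $T_m=\theta_1+\dots+\theta_m$, $T_\infty=\lim_m T_m$, $\xi_t=x_m$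 if $T_m\le t<T_{m+1}$ and $\xi_t=x_\infty$ if $t\ge T_\infty$. Let $\mathcal F_t=\sigma(\{T_m\le s,x_m\in\Gamma\}:\Gamma\in\mathcal B(S),s\le t,m\ge0)$ and $\mathcal F_{s-}=\bigvee_{t<s}\mathcal F_t$; the predictable $\sigma$-algebra on $\Omega\times[0,\infty)$ is generated by the sets $\Gamma\times\{0\}$ ($\Gamma\in\mathcal F_0$) and $\Gamma\times(s,\infty)$ ($s\ge 0$, $\Gamma\in\mathcal F_{s-}$). A policy $\pi$ is a predictable transition probability $\pi(da|\omega,t)$ on $A\cup\{a_\infty\}$ concentrated on $A(\xi_{t-}(\omega))$, where $\xi_{0-}=x_0$, $\xi_{t-}=x_m$ if $T_m<t\le T_{m+1}$, and $\xi_{t-}=x_\infty$ if $t\geq T_\infty$. For a history $h_k=(x_0,\theta_1,\dots,\theta_k,x_k)$ with $\theta_k<\infty$ and $u>0$, let $\Lambda^k(\Gamma|h_k,u)=\int_A\pi(da|\omega,T_k+u)\,q(\Gamma\setminus\{x_k\}|x_k,a)$, where $\omega$ is any path that starts with $h_k$ and has $\theta_{k+1}\ge u$ (by predictability the choice does not matter).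 $P_x^\pi$ is the unique probability measure on $\Omega$ such that $x_0=x$ a.s. and, for every $k\ge0$, the conditional law of $(\theta_{k+1},x_{k+1})$ given $h_k$ on $\{\theta_k<\infty\}$ (on all of $\Omega$ if $k=0$) is $\Lambda^k(dy|h_k,u)\,e^{-\int_0^u\Lambda^k(S|h_k,v)dv}du$ on $(0,\infty)\times S$ with the remaining mass $e^{-\int_0^\infty\Lambda^k(S|h_k,v)dv}$ at $(\infty,x_\infty)$; $E_x^\pi$ is its expectation. **Conditions.** Let $w:S\to[1,\infty)$ be measurable, $\rho\ge0$, $b\ge0$, and let $S_0\subseteq S_1\subseteq\dots$ be measurable subsets of $S$. Consider 1. $\bigcup_lS_l=S$ and $\lim_{l\to\infty}\inf_{x\in S\setminus S_l}w(x)=\infty$ (with $\inf\emptyset=\infty$); 2. $\int_Sq(dy|x,a)w(y)\le\rho w(x)+b$ for all $x\in S$, $a\in A(x)$ (the integral being finite); 3. $\sup_{x\in S_l}\bar q_x<\infty$ for every $l$; 4. there is a constant $L>0$ with $\bar q_x<Lw(x)$ for all $x\in S$. **Theorem.** Let $\pi$ be any policy. (a) Suppose that 1, 2 and 3 hold. Then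 for all $x\in S$, $t\ge0$ and all $\Gamma\in\mathcal B(S)$ that are contained in some $S_l$, $$P_x^\pi(\xi_t\in\Gamma)=I\{x\in\Gamma\}+E_x^\pi\Big[\int_0^t\int_A\pi(da|\omega,u)\,q(\Gamma\setminus\{\xi_u\}|\xi_u,a)\,du\Big]-E_x^\pi\Big[\int_0^t\int_A\pi(da|\omega,u)\,q_{\xi_u}(a)I\{\xi_u\in\Gamma\}\,du\Big],$$ and both expectations are finite. (b) Suppose that 1, 2 and 4 hold. Then for all $x\in S$, $t\ge0$ and all $\Gamma\in\mathcal B(S)$ the same equation holds, and both expectations are finite. -/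

import Mathlib

open MeasureTheory ProbabilityTheory Set Filter Topology
open scoped ENNReal NNReal

noncomputable section

namespace KitaevCTMDP

/-- `X` with one isolated point adjoined (`S_∞ = S ∪ {x_∞}`, `A_∞ = A ∪ {a_∞}`). -/
abbrev WithCemetery (X : Type*) := X ⊕ Unit

/-- The adjoined point `x_∞` (or `a_∞`). -/
abbrev cemetery {X : Type*} : WithCemetery X := Sum.inr ()

/-- Primitives of a continuous-time Markov decision process: admissible actions `A(x)` and the
conservative, stable signed transition rate `q(dy|x,a)`, extended by `0` off the graph
`K = {(x,a) : a ∈ A(x)}`. -/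
structure CTMDP (S A : Type*) [MeasurableSpace S] [MeasurableSpace A] where
  /-- The set `A(x)` of admissible actions. -/
  adm : S → Set A
  measurableSet_graph : MeasurableSet {p : S × A | p.2 ∈ adm p.1}
  exists_selector : ∃ φ : S → A, Measurable φ ∧ ∀ x, φ x ∈ adm x
  /-- The transition rate `q(dy|x,a)`. -/
  q : S → A → SignedMeasure S
  measurable_q : ∀ Γ, MeasurableSet Γ → Measurable fun p : S × A => q p.1 p.2 Γ
  q_off_graph : ∀ x a, a ∉ adm x → q x a = 0
  q_nonneg : ∀ x a, a ∈ adm x → ∀ Γ, MeasurableSet Γ → x ∉ Γ → 0 ≤ q x a Γ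
  q_conservative : ∀ x a, a ∈ adm x → q x a univ = 0
  q_stable : ∀ x, BddAbove ((fun a => -q x a {x}) '' adm x)

variable {S A : Type*} [MeasurableSpace S] [MeasurableSpace A]

namespace CTMDP

variable (M : CTMDP S A)

/-- `q_x(a) = -q({x}|x,a)`. -/
def exitRate (x : S) (a : A) : ℝ := -M.q x a {x}

/-- `q̄_x = sup_{a ∈ A(x)} q_x(a)`. -/
def maxExitRate (x : S) : ℝ := sSup (M.exitRate x '' M.adm x)

/-- `A(x)` for `x ∈ S_∞`, with `A(x_∞) = {a_∞}`. -/
def admExt : WithCemetery S → Set (WithCemetery A)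
  | Sum.inl x => Sum.inl '' M.adm x
  | Sum.inr _ => {cemetery}

theorem q_zero_le [MeasurableSingletonClass S] (x : S) (a : A) :
    0 ≤[({x}ᶜ : Set S)] M.q x a := by
  refine VectorMeasure.restrict_le_restrict_of_subset_le _ _ fun Γ hΓ hsub => ?_
  by_cases ha : a ∈ M.adm x
  · simpa using M.q_nonneg x a ha Γ hΓ fun hx => hsub hx rfl
  · simp [M.q_off_graph x a ha]

/-- The positive measure `Γ ↦ q(Γ \ {x}|x,a)` on `S`. -/
def jumpRate [MeasurableSingletonClass S] (x : S) (a : A) : Measure S :=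
  (M.q x a).toMeasureOfZeroLE {x}ᶜ (measurableSet_singleton x).compl (M.q_zero_le x a)

/-- `Γ ↦ q(Γ \ {x}|x,a)` for `x ∈ S_∞`, `a ∈ A_∞`; it vanishes at `x_∞` and at `a_∞`. -/
def jumpRateExt [MeasurableSingletonClass S] : WithCemetery S → WithCemetery A → Measure S
  | Sum.inl x, Sum.inl a => M.jumpRate x a
  | _, _ => 0

/-- `q_x(a)` for `x ∈ S_∞`, `a ∈ A_∞`; it vanishes at `x_∞` and at `a_∞`. -/
def exitRateExt : WithCemetery S → WithCemetery A → ℝ≥0∞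
  | Sum.inl x, Sum.inl a => ENNReal.ofReal (M.exitRate x a)
  | _, _ => 0

theorem jumpRate_apply [MeasurableSingletonClass S] (x : S) (a : A) {Γ : Set S}
    (hΓ : MeasurableSet Γ) : M.jumpRate x a Γ = ENNReal.ofReal (M.q x a (Γ \ {x})) := by
  have h := SignedMeasure.toMeasureOfZeroLE_real_apply (M.q x a) (M.q_zero_le x a)
    (measurableSet_singleton x).compl hΓ
  have : IsFiniteMeasure (M.jumpRate x a) := by unfold jumpRate; infer_instance
  rw [← ENNReal.ofReal_toReal (measure_ne_top (M.jumpRate x a) Γ)]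
  congr 1
  rw [sdiff_eq, inter_comm]
  exact h

instance [MeasurableSingletonClass S] (x : S) (a : A) : IsFiniteMeasure (M.jumpRate x a) := by
  unfold jumpRate; infer_instance

instance [MeasurableSingletonClass S] (x : WithCemetery S) (a : WithCemetery A) :
    IsFiniteMeasure (M.jumpRateExt x a) := by
  unfold jumpRateExt; split <;> infer_instance

theorem jumpRate_univ_le [MeasurableSingletonClass S] (x : S) (a : A) :
    M.jumpRate x a univ ≤ ENNReal.ofReal (M.maxExitRate x) := by
  by_cases ha : a ∈ M.adm x
  · rw [M.jumpRate_apply x a MeasurableSet.univ]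
    refine ENNReal.ofReal_le_ofReal ?_
    have h1 : M.q x a (univ \ {x}) = M.exitRate x a := by
      have := VectorMeasure.of_sdiff (v := M.q x a) (measurableSet_singleton x)
        MeasurableSet.univ (subset_univ _)
      have h2 := M.q_conservative x a ha
      unfold exitRate
      linarith
    rw [h1]
    exact le_csSup (M.q_stable x) ⟨a, ha, rfl⟩
  · rw [M.jumpRate_apply x a MeasurableSet.univ, M.q_off_graph x a ha]
    simp

/-- A section-wise evaluation of the transition rate is measurable. -/
theorem measurable_q_section (D : Set (S × S)) (hD : MeasurableSet D) :
    Measurable fun p : S × A => M.q p.1 p.2 (Prod.mk p.1 ⁻¹' D) := by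
  classical
  induction D, hD using MeasurableSpace.induction_on_inter generateFrom_prod.symm
    isPiSystem_prod with
  | empty => simp
  | basic t ht =>
    obtain ⟨s, hs, r, hr, rfl⟩ := ht
    have : (fun p : S × A => M.q p.1 p.2 (Prod.mk p.1 ⁻¹' s ×ˢ r)) =
        fun p => if p.1 ∈ s then M.q p.1 p.2 r else 0 := by
      funext p
      by_cases h : p.1 ∈ s <;> simp [h, Set.mk_preimage_prod_right]
    rw [this]
    exact Measurable.ite (measurable_fst hs) (M.measurable_q r hr) measurable_const
  | compl t ht ih =>
    have : (fun p : S × A => M.q p.1 p.2 (Prod.mk p.1 ⁻¹' tᶜ)) =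
        fun p => M.q p.1 p.2 univ - M.q p.1 p.2 (Prod.mk p.1 ⁻¹' t) := by
      funext p
      rw [preimage_compl, compl_eq_univ_sdiff]
      exact VectorMeasure.of_sdiff (measurable_prodMk_left ht) MeasurableSet.univ
        (subset_univ _)
    rw [this]
    exact (M.measurable_q univ MeasurableSet.univ).sub ih
  | iUnion f hd hf ih =>
    refine measurable_of_tendsto_metrizable (f := fun n (p : S × A) =>
      ∑ i ∈ Finset.range n, M.q p.1 p.2 (Prod.mk p.1 ⁻¹' f i))
      (fun n => Finset.measurable_sum _ fun i _ => ih i) ?_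
    rw [tendsto_pi_nhds]
    intro p
    rw [preimage_iUnion]
    exact (VectorMeasure.hasSum_of_disjoint_iUnion
      (fun i => measurable_prodMk_left (hf i))
      (fun i j hij => (hd hij).preimage _)).tendsto_sum_nat

theorem measurable_jumpRateExt [StandardBorelSpace S] :
    Measurable fun p : WithCemetery S × WithCemetery A => M.jumpRateExt p.1 p.2 := by
  refine Measure.measurable_of_measurable_coe _ fun Γ hΓ => ?_
  have key : Measurable fun p : S × A => M.jumpRate p.1 p.2 Γ := by
    have h1 : MeasurableSet ((Prod.snd ⁻¹' Γ) ∩ {p : S × S | p.1 = p.2}ᶜ) :=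
      (measurable_snd hΓ).inter (measurableSet_eq_fun measurable_fst measurable_snd).compl
    have h2 : (fun p : S × A => M.jumpRate p.1 p.2 Γ) = fun p =>
        ENNReal.ofReal (M.q p.1 p.2 (Prod.mk p.1 ⁻¹' ((Prod.snd ⁻¹' Γ) ∩
          {p : S × S | p.1 = p.2}ᶜ))) := by
      funext p
      rw [M.jumpRate_apply p.1 p.2 hΓ]
      congr 2
      ext y
      simp [eq_comm]
    rw [h2]
    exact (M.measurable_q_section _ h1).ennreal_ofReal
  have h3 : Measurable (Sum.elim (Sum.elim (fun p : S × A => M.jumpRate p.1 p.2 Γ) fun _ => 0)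
      (Sum.elim (fun _ : Unit × A => (0 : ℝ≥0∞)) fun _ : Unit × Unit => 0) ∘
        (MeasurableEquiv.sumProdSum S Unit A Unit)) := by
    refine Measurable.comp ?_ (MeasurableEquiv.measurable _)
    exact (key.sumElim measurable_const).sumElim (measurable_const.sumElim measurable_const)
  convert h3 using 1
  funext p
  rcases p with ⟨x | x, a | a⟩ <;> rfl

end CTMDP

/-- One step `(θ_m, x_m)` of a sample path: a sojourn time and the next state. -/
abbrev Step (S : Type*) := ℝ≥0∞ × WithCemetery S

/-- The sequences `((0, x_0), (θ_1, x_1), (θ_2, x_2), …)` that are sample paths: `x_0 ∈ S`, and each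
further step is either in `(0,∞) × S`, and then the previous state lies in `S`, or is `(∞, x_∞)`.
The dummy entry `θ_0 = 0` makes `T_0 = 0`. -/
structure IsPath (s : ℕ → Step S) : Prop where
  sojourn_zero : (s 0).1 = 0
  state_zero : (s 0).2 ≠ cemetery
  step : ∀ m, ((s m).2 ≠ cemetery ∧ (s (m + 1)).2 ≠ cemetery ∧ 0 < (s (m + 1)).1 ∧
    (s (m + 1)).1 < ⊤) ∨ s (m + 1) = (⊤, cemetery)

/-- The sample space `Ω`, with the trace of the product σ-algebra. -/
abbrev Path (S : Type*) [MeasurableSpace S] := {s : ℕ → Step S // IsPath s}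

/-- `T_m = θ_1 + ⋯ + θ_m`. -/
def jumpTime (s : ℕ → Step S) (m : ℕ) : ℝ≥0∞ := ∑ i ∈ Finset.range (m + 1), (s i).1

open Classical in
/-- The process `ξ_t`: equal to `x_m` if `T_m ≤ t < T_{m+1}`, and to `x_∞` if `T_∞ ≤ t`. -/
def xi (t : ℝ≥0) (ω : Path S) : WithCemetery S :=
  if h : ∃ m, jumpTime ω.1 m ≤ t ∧ t < jumpTime ω.1 (m + 1) then (ω.1 (Nat.find h)).2
  else cemetery

open Classical in
/-- The process `ξ_{t-}`: equal to `x_m` if `T_m < t ≤ T_{m+1}`, to `x_0` if `t = 0`, and to `x_∞`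
if `T_∞ ≤ t`. -/
def xiPre (t : ℝ≥0) (ω : Path S) : WithCemetery S :=
  if t = 0 then (ω.1 0).2
  else if h : ∃ m, jumpTime ω.1 m < t ∧ t ≤ jumpTime ω.1 (m + 1) then (ω.1 (Nat.find h)).2
  else cemetery

/-- The history `ℱ_t = σ({T_m ≤ s, x_m ∈ Γ} : Γ ∈ ℬ(S), s ≤ t, m ≥ 0)`. -/
abbrev history (S : Type*) [MeasurableSpace S] (t : ℝ≥0) : MeasurableSpace (Path S) :=
  MeasurableSpace.generateFrom {E | ∃ Γ : Set S, MeasurableSet Γ ∧ ∃ s ≤ t, ∃ m : ℕ,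
    E = {ω : Path S | jumpTime ω.1 m ≤ s ∧ (ω.1 m).2 ∈ Sum.inl '' Γ}}

/-- `ℱ_{t-} = ⋁_{s < t} ℱ_s`. -/
abbrev historyPre (S : Type*) [MeasurableSpace S] (t : ℝ≥0) : MeasurableSpace (Path S) :=
  ⨆ s : Set.Iio t, history S s

/-- The predictable σ-algebra on `Ω × [0,∞)`, generated by `Γ × {0}` with `Γ ∈ ℱ_0` and by
`Γ × (s,∞)` with `Γ ∈ ℱ_{s-}`. -/
abbrev predictableSigma (S : Type*) [MeasurableSpace S] : MeasurableSpace (Path S × ℝ≥0) :=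
  MeasurableSpace.generateFrom
    ({E | ∃ Γ : Set (Path S), MeasurableSet[history S 0] Γ ∧ E = Γ ×ˢ {0}} ∪
      {E | ∃ (s : ℝ≥0) (Γ : Set (Path S)), MeasurableSet[historyPre S s] Γ ∧ E = Γ ×ˢ Ioi s})

/-- A randomized history-dependent policy: a predictable transition probability
`π(da|ω,t)` on `A_∞`, concentrated on `A(ξ_{t-})`. -/
structure Policy (M : CTMDP S A) where
  /-- The measure `π(da|ω,t)`. -/
  act : Path S → ℝ≥0 → Measure (WithCemetery A)
  act_prob : ∀ ω t, act ω t univ = 1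
  act_predictable : ∀ B, MeasurableSet B →
    Measurable[predictableSigma S] fun p : Path S × ℝ≥0 => act p.1 p.2 B
  act_concentrated : ∀ ω t, act ω t (M.admExt (xiPre t ω))ᶜ = 0

theorem measurableSet_cemetery {X : Type*} [MeasurableSpace X] :
    MeasurableSet {(cemetery : WithCemetery X)} := by
  have : {(cemetery : WithCemetery X)} = range Sum.inr := by
    ext y; rcases y with y | y <;> simp
  rw [this]
  exact measurableSet_range_inr

theorem measurableSet_isPath :
    MeasurableSet {s : ℕ → Step S | IsPath s} := by
  have h0 : {s : ℕ → Step S | IsPath s} = {s | (s 0).1 = 0} ∩ {s | (s 0).2 ≠ cemetery} ∩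
      ⋂ m, {s : ℕ → Step S | ((s m).2 ≠ cemetery ∧ (s (m + 1)).2 ≠ cemetery ∧
        0 < (s (m + 1)).1 ∧ (s (m + 1)).1 < ⊤) ∨ s (m + 1) = (⊤, cemetery)} := by
    ext s
    simp only [mem_inter_iff, mem_iInter, mem_ofPred_eq]
    exact ⟨fun h => ⟨⟨h.1, h.2⟩, h.3⟩, fun h => ⟨h.1.1, h.1.2, h.2⟩⟩
  have h1 : ∀ m, Measurable fun s : ℕ → Step S => (s m).1 := fun m => by fun_prop
  have h2 : ∀ m, Measurable fun s : ℕ → Step S => (s m).2 := fun m =>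
    measurable_snd.comp (measurable_pi_apply m)
  have h3 : ∀ m, MeasurableSet {s : ℕ → Step S | (s m).2 ≠ cemetery} := fun m =>
    (h2 m measurableSet_cemetery).compl
  rw [h0]
  refine ((h1 0 (measurableSet_singleton 0)).inter (h3 0)).inter (MeasurableSet.iInter fun m => ?_)
  refine ((h3 m).inter ((h3 (m + 1)).inter ((h1 (m + 1) measurableSet_Ioi).inter
    (h1 (m + 1) measurableSet_Iio)))).union ?_
  have h4 : MeasurableSet {((⊤ : ℝ≥0∞), (cemetery : WithCemetery S))} := by
    rw [← singleton_prod_singleton]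
    exact (measurableSet_singleton _).prod measurableSet_cemetery
  have h5 : Measurable fun s : ℕ → Step S => s (m + 1) := measurable_pi_apply _
  exact h5 h4

theorem measurable_jumpTime (m : ℕ) : Measurable fun s : ℕ → Step S => jumpTime s m := by
  unfold jumpTime
  fun_prop

theorem history_le (t : ℝ≥0) : history S t ≤ (inferInstance : MeasurableSpace (Path S)) := by
  refine MeasurableSpace.generateFrom_le ?_
  rintro E ⟨Γ, hΓ, s, -, m, rfl⟩
  refine MeasurableSet.inter ?_ ?_
  · exact measurableSet_le ((measurable_jumpTime m).comp measurable_subtype_coe) measurable_const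
  · have : Measurable fun ω : Path S => (ω.1 m).2 :=
      measurable_snd.comp ((measurable_pi_apply m).comp measurable_subtype_coe)
    exact this hΓ.inl_image

theorem predictableSigma_le :
    predictableSigma S ≤ (inferInstance : MeasurableSpace (Path S × ℝ≥0)) := by
  refine MeasurableSpace.generateFrom_le ?_
  rintro E (⟨Γ, hΓ, rfl⟩ | ⟨s, Γ, hΓ, rfl⟩)
  · exact (history_le 0 _ hΓ).prod (measurableSet_singleton 0)
  · have : historyPre S s ≤ (inferInstance : MeasurableSpace (Path S)) :=
      iSup_le fun r => history_le r
    exact (this _ hΓ).prod measurableSet_Ioi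

theorem abs_exp_neg_sub_le {a b : ℝ} (ha : 0 ≤ a) (hb : 0 ≤ b) :
    |Real.exp (-a) - Real.exp (-b)| ≤ |a - b| := by
  wlog h : a ≤ b generalizing a b
  · rw [abs_sub_comm, abs_sub_comm a b]; exact this hb ha (le_of_not_ge h)
  have h1 : Real.exp (-b) = Real.exp (-a) * Real.exp (-(b - a)) := by
    rw [← Real.exp_add]; ring_nf
  have h2 : Real.exp (-a) ≤ 1 := Real.exp_le_one_iff.2 (by linarith)
  have h3 := Real.add_one_le_exp (-(b - a))
  have h4 : Real.exp (-b) ≤ Real.exp (-a) := Real.exp_le_exp.2 (by linarith)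
  have h5 := Real.exp_pos (-a)
  have h6 : Real.exp (-(b - a)) ≤ 1 := Real.exp_le_one_iff.2 (by linarith)
  rw [abs_of_nonneg (by linarith), abs_sub_comm, abs_of_nonneg (by linarith), h1]
  nlinarith

theorem ereal_exp_neg {c : ℝ≥0∞} (hc : c ≠ ⊤) :
    EReal.exp (-(c : EReal)) = ENNReal.ofReal (Real.exp (-c.toReal)) := by
  lift c to ℝ≥0 using hc
  rw [← EReal.exp_coe]
  rfl

theorem tendsto_setLIntegral_Ioc (f : ℝ → ℝ≥0∞) :
    Tendsto (fun n : ℕ => ∫⁻ u in Ioc (0 : ℝ) n, f u) atTop (𝓝 (∫⁻ u in Ioi (0 : ℝ), f u)) := by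
  have h : ⋃ n : ℕ, Ioc (0 : ℝ) n = Ioi 0 := by
    ext x
    simp only [mem_iUnion, mem_Ioc, mem_Ioi]
    exact ⟨fun ⟨_, h⟩ => h.1, fun h => (exists_nat_ge x).imp fun n hn => ⟨h, hn⟩⟩
  rw [← h]
  have hm : Monotone fun n : ℕ => Ioc (0 : ℝ) n := fun m n hmn =>
    Ioc_subset_Ioc_right (by exact_mod_cast hmn)
  have := tendsto_measure_iUnion_atTop (μ := volume.withDensity f) hm
  rw [withDensity_apply _ (MeasurableSet.iUnion fun n => measurableSet_Ioc)] at this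
  refine this.congr fun n => ?_
  simp [withDensity_apply _ measurableSet_Ioc]

theorem lintegral_hazard_Ioc {f : ℝ → ℝ≥0∞} (hf : Measurable f) {C : ℝ≥0∞} (hC : C ≠ ⊤)
    (hfC : ∀ u, f u ≤ C) {t : ℝ} (ht : 0 ≤ t) :
    (∫⁻ u in Ioc 0 t, EReal.exp (-((∫⁻ v in Ioc 0 u, f v : ℝ≥0∞) : EReal)) * f u) +
      EReal.exp (-((∫⁻ v in Ioc 0 t, f v : ℝ≥0∞) : EReal)) = 1 := by
  have hft : ∀ u, f u ≠ ⊤ := fun u => ne_top_of_le_ne_top hC (hfC u)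
  set g : ℝ → ℝ := fun u => (f u).toReal with hg
  have hgm : Measurable g := hf.ennreal_toReal
  have hg0 : ∀ u, 0 ≤ g u := fun u => ENNReal.toReal_nonneg
  have hgC : ∀ u, g u ≤ C.toReal := fun u => ENNReal.toReal_mono hC (hfC u)
  have hgi : ∀ a b, IntervalIntegrable g volume a b := fun a b =>
    (intervalIntegrable_const (c := C.toReal)).mono_fun hgm.aestronglyMeasurable
      (ae_of_all _ fun u => by
        change ‖g u‖ ≤ ‖C.toReal‖
        rw [Real.norm_of_nonneg (hg0 u), Real.norm_of_nonneg ENNReal.toReal_nonneg]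
        exact hgC u)
  set G : ℝ → ℝ := fun u => ∫ v in 0..u, g v with hG
  have hG0 : ∀ u, 0 ≤ u → 0 ≤ G u := fun u hu =>
    intervalIntegral.integral_nonneg hu fun v _ => hg0 v
  have hH : ∀ u, 0 ≤ u → ∫⁻ v in Ioc 0 u, f v = ENNReal.ofReal (G u) := fun u hu => by
    rw [hG]
    simp only
    rw [intervalIntegral.integral_of_le hu, ofReal_integral_eq_lintegral_ofReal
      ((intervalIntegrable_iff_integrableOn_Ioc_of_le hu).1 (hgi 0 u)) (ae_of_all _ hg0)]
    exact lintegral_congr fun v => (ENNReal.ofReal_toReal (hft v)).symm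
  have hE : ∀ u, 0 ≤ u → EReal.exp (-((∫⁻ v in Ioc 0 u, f v : ℝ≥0∞) : EReal)) =
      ENNReal.ofReal (Real.exp (-G u)) := fun u hu => by
    rw [hH u hu, ereal_exp_neg ENNReal.ofReal_ne_top, ENNReal.toReal_ofReal (hG0 u hu)]
  have hGcont : Continuous G := intervalIntegral.continuous_primitive hgi 0
  have hLip : LipschitzOnWith C.toNNReal (fun u => Real.exp (-G u)) (uIcc 0 t) := by
    refine LipschitzOnWith.of_dist_le_mul fun x hx y hy => ?_
    rw [uIcc_of_le ht] at hx hy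
    rw [Real.dist_eq]
    refine (abs_exp_neg_sub_le (hG0 x hx.1) (hG0 y hy.1)).trans ?_
    rw [hG]
    simp only
    rw [intervalIntegral.integral_interval_sub_left (hgi _ _) (hgi _ _), Real.dist_eq,
      ← Real.norm_eq_abs]
    refine intervalIntegral.norm_integral_le_of_norm_le_const fun v _ => ?_
    rw [Real.norm_of_nonneg (hg0 v)]; exact hgC v
  have hFTC := hLip.absolutelyContinuousOnInterval.integral_deriv_eq_sub
  have hder : ∀ᵐ u, u ∈ uIoc 0 t → deriv (fun u => Real.exp (-G u)) u =
      -(Real.exp (-G u) * g u) := by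
    filter_upwards [(hgi 0 t).ae_hasDerivAt_integral] with u hu hut
    have : HasDerivAt (fun u => Real.exp (-G u)) (Real.exp (-G u) * -g u) u :=
      ((hu (uIoc_subset_uIcc hut) 0 (by simp)).neg).exp
    rw [this.deriv]
    ring
  rw [intervalIntegral.integral_congr_ae hder, intervalIntegral.integral_neg] at hFTC
  have hG00 : G 0 = 0 := by simp [hG]
  simp only [hG00, neg_zero, Real.exp_zero] at hFTC
  have hint : IntegrableOn (fun u => Real.exp (-G u) * g u) (Ioc 0 t) :=
    (intervalIntegrable_iff_integrableOn_Ioc_of_le ht).1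
      ((hgi 0 t).continuousOn_mul (by fun_prop))
  have h1 : ∫⁻ u in Ioc 0 t, EReal.exp (-((∫⁻ v in Ioc 0 u, f v : ℝ≥0∞) : EReal)) * f u =
      ENNReal.ofReal (1 - Real.exp (-G t)) := by
    have : ∫ u in (0 : ℝ)..t, Real.exp (-G u) * g u = 1 - Real.exp (-G t) := by linarith
    rw [← this, intervalIntegral.integral_of_le ht, ofReal_integral_eq_lintegral_ofReal hint
      (ae_of_all _ fun u => mul_nonneg (Real.exp_pos _).le (hg0 u))]
    refine setLIntegral_congr_fun measurableSet_Ioc fun u hu => ?_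
    rw [hE u hu.1.le, ENNReal.ofReal_mul (Real.exp_pos _).le, ENNReal.ofReal_toReal (hft u)]
  rw [h1, hE t ht, ← ENNReal.ofReal_add _ (Real.exp_pos _).le]
  · simp
  · have : Real.exp (-G t) ≤ 1 := Real.exp_le_one_iff.2 (by linarith [hG0 t ht])
    linarith

/-- The sojourn time law has total mass one. -/
theorem lintegral_hazard_Ioi {f : ℝ → ℝ≥0∞} (hf : Measurable f) {C : ℝ≥0∞} (hC : C ≠ ⊤)
    (hfC : ∀ u, f u ≤ C) :
    (∫⁻ u in Ioi 0, EReal.exp (-((∫⁻ v in Ioc 0 u, f v : ℝ≥0∞) : EReal)) * f u) +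
      EReal.exp (-((∫⁻ v in Ioi 0, f v : ℝ≥0∞) : EReal)) = 1 := by
  have h1 := tendsto_setLIntegral_Ioc
    fun u => EReal.exp (-((∫⁻ v in Ioc 0 u, f v : ℝ≥0∞) : EReal)) * f u
  have h2 : Tendsto (fun n : ℕ => EReal.exp (-((∫⁻ v in Ioc 0 (n : ℝ), f v : ℝ≥0∞) : EReal)))
      atTop (𝓝 (EReal.exp (-((∫⁻ v in Ioi 0, f v : ℝ≥0∞) : EReal)))) :=
    (ENNReal.continuous_exp.tendsto _).comp
      ((continuous_neg.tendsto _).comp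
        ((continuous_coe_ennreal_ereal.tendsto _).comp (tendsto_setLIntegral_Ioc f)))
  refine tendsto_nhds_unique (h1.add h2) (tendsto_const_nhds.congr fun n => ?_)
  exact (lintegral_hazard_Ioc hf hC hfC n.cast_nonneg).symm

/-- A finite history `h_k = (x_0, θ_1, x_1, …, θ_k, x_k)`. -/
abbrev Hist (S : Type*) (k : ℕ) := Π _ : Finset.Iic k, Step S

/-- The sequence which follows `h_k` and makes no jump afterwards. -/
def extend (k : ℕ) (h : Hist S k) : ℕ → Step S := fun n =>
  if hn : n ≤ k then h ⟨n, Finset.mem_Iic.2 hn⟩ else (⊤, cemetery)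

theorem measurable_extend (k : ℕ) : Measurable (extend k : Hist S k → ℕ → Step S) := by
  refine measurable_pi_lambda _ fun n => ?_
  unfold extend
  split_ifs <;> fun_prop

/-- The last state `x_k` of the history `h_k`. -/
def lastState (k : ℕ) (h : Hist S k) : WithCemetery S := (h ⟨k, Finset.mem_Iic.2 le_rfl⟩).2

namespace Policy

variable {M : CTMDP S A} (π : Policy M)

open Classical in
/-- The policy evaluated along a sequence; sequences that are not sample paths get the action
`a_∞`, under which there are no jumps. -/
def actSeq (s : ℕ → Step S) (t : ℝ≥0) : Measure (WithCemetery A) :=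
  if hs : IsPath s then π.act ⟨s, hs⟩ t else Measure.dirac cemetery

/-- `π^k(da|h_k,u)`, the policy at time `T_k + u` given that the history is `h_k` and no jump
occurred in `(T_k, T_k + u)`. By predictability, `π(da|ω,T_k+u) = π^k(da|h_k,u)` for each `ω` that
starts with `h_k` and satisfies `T_k < T_k + u ≤ T_{k+1}`. -/
def actHist (k : ℕ) (h : Hist S k) (u : ℝ) : Measure (WithCemetery A) :=
  π.actSeq (extend k h) ((jumpTime (extend k h) k).toNNReal + u.toNNReal)

instance (s : ℕ → Step S) (t : ℝ≥0) : IsProbabilityMeasure (π.actSeq s t) := by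
  unfold actSeq
  split_ifs with hs
  · exact ⟨π.act_prob _ _⟩
  · infer_instance

instance (k : ℕ) (h : Hist S k) (u : ℝ) : IsProbabilityMeasure (π.actHist k h u) := by
  unfold actHist; infer_instance

theorem measurable_actHist (k : ℕ) :
    Measurable fun p : Hist S k × ℝ => π.actHist k p.1 p.2 := by
  classical
  refine Measure.measurable_of_measurable_coe _ fun B hB => ?_
  have h1 : Measurable fun p : (ℕ → Step S) × ℝ≥0 => π.actSeq p.1 p.2 B := by
    have hs : MeasurableSet {p : (ℕ → Step S) × ℝ≥0 | IsPath p.1} :=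
      measurable_fst measurableSet_isPath
    refine measurable_of_restrict_of_restrict_compl hs ?_ ?_
    · have h2 : ({p : (ℕ → Step S) × ℝ≥0 | IsPath p.1}.domRestrict fun p => π.actSeq p.1 p.2 B) =
          (fun p : Path S × ℝ≥0 => π.act p.1 p.2 B) ∘
            fun p => (⟨p.1.1, p.2⟩, p.1.2) := by
        funext p
        have hp : IsPath p.1.1 := p.2
        simp [actSeq, hp, domRestrict_apply]
      rw [h2]
      refine ((π.act_predictable B hB).mono predictableSigma_le le_rfl).comp ?_
      exact ((measurable_fst.comp measurable_subtype_coe).subtype_mk).prodMk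
        (measurable_snd.comp measurable_subtype_coe)
    · have h2 : ({p : (ℕ → Step S) × ℝ≥0 | IsPath p.1}ᶜ.domRestrict fun p => π.actSeq p.1 p.2 B) =
          fun _ => Measure.dirac cemetery B := by
        funext p
        have hp : ¬ IsPath p.1.1 := p.2
        simp [actSeq, hp, domRestrict_apply]
      rw [h2]
      exact measurable_const
  have h3 : Measurable fun p : Hist S k × ℝ => extend k p.1 :=
    (measurable_extend k).comp measurable_fst
  exact h1.comp (h3.prodMk (((measurable_jumpTime k).comp h3).ennreal_toNNReal.add
    measurable_snd.real_toNNReal))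

/-- The jump intensity `Λ^k(Γ|h_k,u) = ∫_A π^k(da|h_k,u) q(Γ \ {x_k}|x_k,a)`. -/
def intensity [MeasurableSingletonClass S] (k : ℕ) (h : Hist S k) (u : ℝ) : Measure S :=
  (π.actHist k h u).bind (M.jumpRateExt (lastState k h))

/-- `∫_0^u Λ^k(S|h_k,v) dv`. -/
def hazard [MeasurableSingletonClass S] (k : ℕ) (h : Hist S k) (u : ℝ) : ℝ≥0∞ :=
  ∫⁻ v in Ioc 0 u, π.intensity k h v univ

/-- `∫_0^∞ Λ^k(S|h_k,v) dv`. -/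
def totalHazard [MeasurableSingletonClass S] (k : ℕ) (h : Hist S k) : ℝ≥0∞ :=
  ∫⁻ v in Ioi 0, π.intensity k h v univ

/-- The conditional law of `(θ_{k+1}, x_{k+1})` given `h_k`: on `(0,∞) × S` it is
`Λ^k(dy|h_k,u) exp(-∫_0^u Λ^k(S|h_k,v) dv) du`, and `(∞, x_∞)` has mass
`exp(-∫_0^∞ Λ^k(S|h_k,v) dv)`. (If `x_k = x_∞` then `Λ^k = 0`, so this is the point mass at
`(∞, x_∞)`.) -/
def stepLaw [MeasurableSingletonClass S] (k : ℕ) (h : Hist S k) : Measure (Step S) :=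
  ((volume.restrict (Ioi (0 : ℝ))).bind fun u => EReal.exp (-(π.hazard k h u : EReal)) •
      (π.intensity k h u).map fun y => (ENNReal.ofReal u, Sum.inl y)) +
    EReal.exp (-(π.totalHazard k h : EReal)) • Measure.dirac (⊤, cemetery)

theorem measurable_initHist :
    Measurable fun x : S => (fun _ => (0, Sum.inl x) : Hist S 0) :=
  measurable_pi_lambda _ fun _ => measurable_const.prodMk measurable_inl

variable [StandardBorelSpace S]

theorem intensity_apply (k : ℕ) (h : Hist S k) (u : ℝ) {Γ : Set S} (hΓ : MeasurableSet Γ) :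
    π.intensity k h u Γ = ∫⁻ a, M.jumpRateExt (lastState k h) a Γ ∂π.actHist k h u := by
  refine Measure.bind_apply hΓ ?_
  exact (M.measurable_jumpRateExt.comp measurable_prodMk_left).aemeasurable

theorem intensity_univ_le (k : ℕ) (h : Hist S k) :
    ∃ C : ℝ≥0∞, C ≠ ⊤ ∧ ∀ u, π.intensity k h u univ ≤ C := by
  have key : ∃ C : ℝ≥0∞, C ≠ ⊤ ∧ ∀ a, M.jumpRateExt (lastState k h) a univ ≤ C := by
    rcases lastState k h with x | x
    · refine ⟨ENNReal.ofReal (M.maxExitRate x), ENNReal.ofReal_ne_top, fun a => ?_⟩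
      rcases a with a | a
      · exact M.jumpRate_univ_le x a
      · exact bot_le
    · exact ⟨0, ENNReal.zero_ne_top, fun a => le_of_eq (by rcases a with a | a <;> rfl)⟩
  obtain ⟨C, hC, hle⟩ := key
  refine ⟨C, hC, fun u => ?_⟩
  rw [π.intensity_apply k h u MeasurableSet.univ]
  exact (lintegral_mono hle).trans (by simp)

theorem measurable_intensity (k : ℕ) :
    Measurable fun p : Hist S k × ℝ => π.intensity k p.1 p.2 := by
  refine Measure.measurable_of_measurable_coe _ fun Γ hΓ => ?_
  simp only [π.intensity_apply k _ _ hΓ]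
  let κ : Kernel (Hist S k × ℝ) (WithCemetery A) :=
    ⟨fun p => π.actHist k p.1 p.2, π.measurable_actHist k⟩
  have : IsMarkovKernel κ :=
    ⟨fun p => inferInstanceAs (IsProbabilityMeasure (π.actHist k p.1 p.2))⟩
  have h1 : Measurable fun p : (Hist S k × ℝ) × WithCemetery A => (lastState k p.1.1, p.2) :=
    (measurable_snd.comp ((measurable_pi_apply _).comp
      (measurable_fst.comp measurable_fst))).prodMk measurable_snd
  have h2 : Measurable fun p : (Hist S k × ℝ) × WithCemetery A =>
      M.jumpRateExt (lastState k p.1.1) p.2 Γ :=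
    (Measure.measurable_coe hΓ).comp (M.measurable_jumpRateExt.comp h1)
  exact h2.lintegral_kernel_prod_right' (κ := κ)

theorem measurable_intensity_univ (k : ℕ) :
    Measurable fun p : Hist S k × ℝ => π.intensity k p.1 p.2 univ :=
  (Measure.measurable_coe MeasurableSet.univ).comp (π.measurable_intensity k)

theorem measurable_hazard (k : ℕ) :
    Measurable fun p : Hist S k × ℝ => π.hazard k p.1 p.2 := by
  have h0 : Measurable fun p : (Hist S k × ℝ) × ℝ => (p.1.1, p.2) :=
    (measurable_fst.comp measurable_fst).prodMk measurable_snd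
  have h1 : Measurable fun p : (Hist S k × ℝ) × ℝ => π.intensity k p.1.1 p.2 univ := by
    have := Measurable.comp (π.measurable_intensity_univ k) h0
    simpa only [Function.comp_def] using this
  have h2 : MeasurableSet {p : (Hist S k × ℝ) × ℝ | p.2 ∈ Ioc 0 p.1.2} :=
    (measurableSet_lt measurable_const measurable_snd).inter
      (measurableSet_le measurable_snd (measurable_snd.comp measurable_fst))
  have h3 : (fun p : Hist S k × ℝ => π.hazard k p.1 p.2) = fun p => ∫⁻ v,
      {p : (Hist S k × ℝ) × ℝ | p.2 ∈ Ioc 0 p.1.2}.indicator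
        (fun p => π.intensity k p.1.1 p.2 univ) (p, v) := by
    funext p
    rw [hazard, ← lintegral_indicator measurableSet_Ioc]
    rfl
  rw [h3]
  exact (h1.indicator h2).lintegral_prod_right'

theorem measurable_totalHazard (k : ℕ) : Measurable (π.totalHazard k) := by
  exact (π.measurable_intensity_univ k).lintegral_prod_right'

theorem measurable_expHazard (k : ℕ) :
    Measurable fun p : Hist S k × ℝ => EReal.exp (-(π.hazard k p.1 p.2 : EReal)) :=
  EReal.measurable_exp.comp ((π.measurable_hazard k).coe_ereal_ennreal.neg)

theorem measurable_stepDensity (k : ℕ) :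
    Measurable fun p : Hist S k × ℝ => EReal.exp (-(π.hazard k p.1 p.2 : EReal)) •
      (π.intensity k p.1 p.2).map fun y => (ENNReal.ofReal p.2, (Sum.inl y : WithCemetery S)) := by
  refine Measure.measurable_of_measurable_coe _ fun E hE => ?_
  simp only [Measure.smul_apply, smul_eq_mul]
  refine (π.measurable_expHazard k).mul ?_
  let κ : Kernel (Hist S k × ℝ) S :=
    ⟨fun p => π.intensity k p.1 p.2, π.measurable_intensity k⟩
  have hκ : ∀ p, IsFiniteMeasure (κ p) := fun p => by
    obtain ⟨C, hC, hle⟩ := π.intensity_univ_le k p.1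
    exact ⟨(hle p.2).trans_lt hC.lt_top⟩
  have h1 : Measurable fun p : (Hist S k × ℝ) × S =>
      (ENNReal.ofReal p.1.2, (Sum.inl p.2 : WithCemetery S)) :=
    (measurable_snd.comp measurable_fst).ennreal_ofReal.prodMk (measurable_inl.comp measurable_snd)
  have h2 := Kernel.measurable_kernel_prodMk_left_of_finite (κ := κ) (h1 hE) hκ
  convert h2 using 2 with p
  exact Measure.map_apply (measurable_const.prodMk measurable_inl) hE

theorem measurable_stepDensity_left (k : ℕ) (h : Hist S k) :
    Measurable fun u : ℝ => EReal.exp (-(π.hazard k h u : EReal)) •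
      (π.intensity k h u).map fun y => (ENNReal.ofReal u, (Sum.inl y : WithCemetery S)) :=
  (π.measurable_stepDensity k).comp measurable_prodMk_left

theorem stepLaw_apply (k : ℕ) (h : Hist S k) {E : Set (Step S)} (hE : MeasurableSet E) :
    π.stepLaw k h E = (∫⁻ u in Ioi (0 : ℝ), EReal.exp (-(π.hazard k h u : EReal)) *
        π.intensity k h u {y | (ENNReal.ofReal u, Sum.inl y) ∈ E}) +
      EReal.exp (-(π.totalHazard k h : EReal)) * Measure.dirac (⊤, cemetery) E := by
  rw [stepLaw, Measure.add_apply, Measure.bind_apply hE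
    (π.measurable_stepDensity_left k h).aemeasurable]
  congr 1
  refine lintegral_congr fun u => ?_
  rw [Measure.smul_apply, smul_eq_mul,
    Measure.map_apply (measurable_const.prodMk measurable_inl) hE]
  rfl

theorem measurable_stepLaw (k : ℕ) : Measurable (π.stepLaw k) := by
  refine Measure.measurable_of_measurable_coe _ fun E hE => ?_
  have h1 : Measurable fun h : Hist S k => EReal.exp (-(π.totalHazard k h : EReal)) :=
    EReal.measurable_exp.comp ((π.measurable_totalHazard k).coe_ereal_ennreal.neg)
  have h2 := ((Measure.measurable_coe hE).comp
    (π.measurable_stepDensity k)).lintegral_prod_right' (ν := volume.restrict (Ioi (0 : ℝ)))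
  have h3 : (fun h => π.stepLaw k h E) = fun h => (∫⁻ u in Ioi (0 : ℝ),
      (EReal.exp (-(π.hazard k h u : EReal)) • (π.intensity k h u).map
        fun y => (ENNReal.ofReal u, (Sum.inl y : WithCemetery S))) E) +
      EReal.exp (-(π.totalHazard k h : EReal)) * Measure.dirac (⊤, cemetery) E := by
    funext h
    rw [stepLaw, Measure.add_apply, Measure.bind_apply hE
      (π.measurable_stepDensity_left k h).aemeasurable]
    rfl
  rw [h3]
  exact h2.add (h1.mul_const _)

theorem stepLaw_univ (k : ℕ) (h : Hist S k) : π.stepLaw k h univ = 1 := by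
  obtain ⟨C, hC, hle⟩ := π.intensity_univ_le k h
  have hm : Measurable fun u => π.intensity k h u univ :=
    Measurable.of_uncurry_left (f := fun h u => π.intensity k h u univ)
      (π.measurable_intensity_univ k)
  have h1 := lintegral_hazard_Ioi hm hC hle
  rw [π.stepLaw_apply k h MeasurableSet.univ]
  have h2 : ∀ u : ℝ, {y : S | (ENNReal.ofReal u, (Sum.inl y : WithCemetery S)) ∈ univ} = univ :=
    fun u => eq_univ_of_forall fun y => mem_univ _
  simp only [h2, measure_univ, mul_one]
  exact h1

/-- The step laws as Markov kernels. -/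
def stepKernel (k : ℕ) : Kernel (Hist S k) (Step S) where
  toFun := π.stepLaw k
  measurable' := π.measurable_stepLaw k

instance (k : ℕ) : IsMarkovKernel (π.stepKernel k) := ⟨fun h => ⟨π.stepLaw_univ k h⟩⟩

/-- The law, on all sequences, of the chain that starts from `x_0 ~ γ` and has the step laws above
(Ionescu-Tulcea). -/
def seqLaw (γ : Measure S) : Measure (ℕ → Step S) :=
  (γ.map fun x => (fun _ => (0, Sum.inl x) : Hist S 0)).bind
    (Kernel.traj (X := fun _ => Step S) π.stepKernel 0)

/-- `P_γ^π` on the sample space `Ω`. -/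
def law (γ : Measure S) : Measure (Path S) := (π.seqLaw γ).comap Subtype.val

/-- `P_x^π`. -/
def lawAt (x : S) : Measure (Path S) := π.law (Measure.dirac x)

theorem stepLaw_ae (k : ℕ) (h : Hist S k) : ∀ᵐ z ∂π.stepLaw k h,
    (lastState k h ≠ cemetery ∧ z.2 ≠ cemetery ∧ 0 < z.1 ∧ z.1 < ⊤) ∨ z = (⊤, cemetery) := by
  have h4 : MeasurableSet {((⊤ : ℝ≥0∞), (cemetery : WithCemetery S))} := by
    rw [← singleton_prod_singleton]
    exact (measurableSet_singleton _).prod measurableSet_cemetery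
  have hE : MeasurableSet {z : Step S |
      (lastState k h ≠ cemetery ∧ z.2 ≠ cemetery ∧ 0 < z.1 ∧ z.1 < ⊤) ∨ z = (⊤, cemetery)} := by
    refine MeasurableSet.union ((MeasurableSet.const _).inter ?_) h4
    exact (measurable_snd measurableSet_cemetery).compl.inter
      ((measurable_fst measurableSet_Ioi).inter (measurable_fst measurableSet_Iio))
  rw [ae_iff]
  refine (π.stepLaw_apply k h hE.compl).trans ?_
  have h0 : Measure.dirac ((⊤ : ℝ≥0∞), (cemetery : WithCemetery S)) {z : Step S |
      (lastState k h ≠ cemetery ∧ z.2 ≠ cemetery ∧ 0 < z.1 ∧ z.1 < ⊤) ∨ z = (⊤, cemetery)}ᶜ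
        = 0 := by
    rw [Measure.dirac_apply' _ hE.compl]
    simp
  rw [h0, mul_zero, add_zero]
  refine (setLIntegral_congr_fun measurableSet_Ioi fun u hu => ?_).trans lintegral_zero
  by_cases hl : lastState k h = cemetery
  · have : π.intensity k h u univ = 0 := by
      rw [π.intensity_apply k h u MeasurableSet.univ, hl]
      refine (lintegral_congr fun a => ?_).trans lintegral_zero
      rcases a with a | a <;> rfl
    rw [measure_mono_null (subset_univ _) this, mul_zero]
  · have : {y : S | (ENNReal.ofReal u, (Sum.inl y : WithCemetery S)) ∈ {z : Step S |
      (lastState k h ≠ cemetery ∧ z.2 ≠ cemetery ∧ 0 < z.1 ∧ z.1 < ⊤) ∨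
        z = (⊤, cemetery)}ᶜ} = ∅ := by
      ext y
      have hu' : 0 < u := hu
      simp [hl, hu']
    rw [this, measure_empty, mul_zero]

theorem traj_ae_mem (k : ℕ) (h : Hist S k) {B : Set (Step S)} (hB : MeasurableSet B)
    (hh : h ⟨k, Finset.mem_Iic.2 le_rfl⟩ ∈ B) :
    ∀ᵐ s ∂Kernel.traj (X := fun _ => Step S) π.stepKernel k h, s k ∈ B := by
  have h1 := Kernel.traj_map_frestrictLe_apply (X := fun _ => Step S) (κ := π.stepKernel) k k h
  rw [Kernel.partialTraj_self, Kernel.id_apply] at h1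
  have h2 : MeasurableSet {g : Hist S k | g ⟨k, Finset.mem_Iic.2 le_rfl⟩ ∈ Bᶜ} :=
    measurable_pi_apply _ hB.compl
  have h3 := congrArg (fun μ => μ {g : Hist S k | g ⟨k, Finset.mem_Iic.2 le_rfl⟩ ∈ Bᶜ}) h1
  rw [Measure.map_apply (Preorder.measurable_frestrictLe k) h2, Measure.dirac_apply' _ h2] at h3
  rw [ae_iff]
  refine Eq.trans ?_ (h3.trans (by simp [hh]))
  rfl

theorem traj_ae_isPath (x : S) : ∀ᵐ s ∂Kernel.traj (X := fun _ => Step S) π.stepKernel 0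
    (fun _ => (0, Sum.inl x)), IsPath s := by
  have hc : MeasurableSet {z : Step S | z.2 ≠ cemetery} :=
    (measurable_snd measurableSet_cemetery).compl
  have hc' : MeasurableSet {z : Step S | z.2 = cemetery} := measurable_snd measurableSet_cemetery
  have h4 : MeasurableSet {((⊤ : ℝ≥0∞), (cemetery : WithCemetery S))} := by
    rw [← singleton_prod_singleton]
    exact (measurableSet_singleton _).prod measurableSet_cemetery
  have hR : ∀ k, MeasurableSet {s : ℕ → Step S | ((s k).2 ≠ cemetery ∧ (s (k + 1)).2 ≠ cemetery ∧
        0 < (s (k + 1)).1 ∧ (s (k + 1)).1 < ⊤) ∨ s (k + 1) = (⊤, cemetery)} := by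
    intro k
    have h5 : ∀ m, Measurable fun s : ℕ → Step S => s m := fun m => measurable_pi_apply m
    exact ((h5 k hc).inter ((h5 (k + 1) hc).inter
      ((h5 (k + 1) (measurable_fst measurableSet_Ioi)).inter
        (h5 (k + 1) (measurable_fst measurableSet_Iio))))).union (h5 (k + 1) h4)
  have h1 : ∀ k, ∀ᵐ s ∂Kernel.traj (X := fun _ => Step S) π.stepKernel 0
      (fun _ => (0, Sum.inl x)), ((s k).2 ≠ cemetery ∧ (s (k + 1)).2 ≠ cemetery ∧
        0 < (s (k + 1)).1 ∧ (s (k + 1)).1 < ⊤) ∨ s (k + 1) = (⊤, cemetery) := by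
    intro k
    rw [← Kernel.traj_comp_partialTraj (X := fun _ => Step S) (κ := π.stepKernel) (Nat.zero_le k)]
    refine Kernel.ae_comp_of_ae_ae (hR k) (ae_of_all _ fun h => ?_)
    have h6 := π.stepLaw_ae k h
    have h7 : (Kernel.traj (X := fun _ => Step S) π.stepKernel k h).map (fun s => s (k + 1)) =
        π.stepLaw k h := by
      have := Kernel.map_traj_succ_self (X := fun _ => Step S) (κ := π.stepKernel) (a := k)
      rw [← Kernel.map_apply _ (by fun_prop), this]
      rfl
    rw [← h7] at h6
    have h8 := ae_of_ae_map (measurable_pi_apply (k + 1)).aemeasurable h6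
    by_cases hl : lastState k h = cemetery
    · filter_upwards [h8] with s hs
      exact Or.inr (hs.resolve_left fun h => h.1 hl)
    · filter_upwards [h8, π.traj_ae_mem k h hc hl] with s hs hs'
      exact hs.imp_left fun h => ⟨hs', h.2⟩
  filter_upwards [π.traj_ae_mem 0 (fun _ => (0, Sum.inl x))
      (measurable_fst (measurableSet_singleton 0)) rfl,
    π.traj_ae_mem 0 (fun _ => (0, Sum.inl x)) hc Sum.inl_ne_inr, ae_all_iff.2 h1] with s ha hb hs
  exact ⟨ha, hb, hs⟩

instance (γ : Measure S) [IsProbabilityMeasure γ] : IsProbabilityMeasure (π.law γ) := by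
  have hm : IsProbabilityMeasure (γ.map fun x => (fun _ => (0, Sum.inl x) : Hist S 0)) :=
    Measure.isProbabilityMeasure_map measurable_initHist.aemeasurable
  constructor
  rw [law, Measure.comap_apply _ Subtype.val_injective
    (fun s hs => measurableSet_isPath.subtype_image hs) _ MeasurableSet.univ, image_univ,
    Subtype.range_coe]
  have h1 : IsProbabilityMeasure (π.seqLaw γ) := by
    unfold seqLaw; infer_instance
  refine (prob_compl_eq_zero_iff measurableSet_isPath).1 ?_
  rw [seqLaw, Measure.bind_apply measurableSet_isPath.compl (Kernel.aemeasurable _),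
    lintegral_map (Kernel.measurable_coe _ measurableSet_isPath.compl) measurable_initHist]
  exact (lintegral_congr fun x => π.traj_ae_isPath x).trans lintegral_zero

instance (x : S) : IsProbabilityMeasure (π.lawAt x) := by
  unfold lawAt; infer_instance

/-- `E_x^π[∫_0^t ∫_A π(da|ω,u) q(Γ \ {ξ_u}|ξ_u,a) du]`. -/
def expectedInflow (x : S) (t : ℝ≥0) (Γ : Set S) : ℝ≥0∞ :=
  ∫⁻ ω, (∫⁻ u in Ioc (0 : ℝ) t,
    (∫⁻ a, M.jumpRateExt (xi u.toNNReal ω) a Γ ∂π.act ω u.toNNReal)) ∂π.lawAt x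

/-- `E_x^π[∫_0^t ∫_A π(da|ω,u) q_{ξ_u}(a) I{ξ_u ∈ Γ} du]`. -/
def expectedOutflow (x : S) (t : ℝ≥0) (Γ : Set S) : ℝ≥0∞ :=
  ∫⁻ ω, (∫⁻ u in Ioc (0 : ℝ) t,
    (∫⁻ a, M.exitRateExt (xi u.toNNReal ω) a *
      (Sum.inl '' Γ).indicator 1 (xi u.toNNReal ω) ∂π.act ω u.toNNReal)) ∂π.lawAt x

end Policy

/-- Parts (a) and (b) of the Lyapunov condition: `w ≥ 1` is measurable, the measurable sets `S_l`
increase to `S` with `inf_{x ∉ S_l} w(x) → ∞` (where `inf ∅ = ∞`), and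
`∫ q(dy|x,a) w(y) ≤ ρ w(x) + b` for all `x` and `a ∈ A(x)`. -/
structure IsLyapunov (M : CTMDP S A) (w : S → ℝ) (Sl : ℕ → Set S) (ρ b : ℝ) : Prop where
  measurable_weight : Measurable w
  one_le_weight : ∀ x, 1 ≤ w x
  rho_nonneg : 0 ≤ ρ
  b_nonneg : 0 ≤ b
  measurableSet_level : ∀ l, MeasurableSet (Sl l)
  monotone_level : Monotone Sl
  iUnion_level : ⋃ l, Sl l = univ
  tendsto_weight : Tendsto (fun l => ⨅ x ∈ (Sl l)ᶜ, (w x : EReal)) atTop (𝓝 ⊤)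
  integrable_weight : ∀ x, ∀ a ∈ M.adm x, (M.q x a).Integrable w
  drift : ∀ x, ∀ a ∈ M.adm x, ∫ᵛ y, w y ∂•(M.q x a) ≤ ρ * w x + b

end KitaevCTMDP

end

noncomputable section

namespace KitaevCTMDP

variable {S A : Type*}

/-! The proof is a balance of arrivals in and departures from `Γ`, jump by jump. Given `h_k`, the
next step has density `exp(-∫_0^u Λ^k) Λ^k(dy|h_k,u)`, and the exponential is exactly the
probability that no jump has occurred by `T_k + u`. Hence `E[c(h_k) f(x_{k+1}); T_{k+1} ≤ t]` equals
the expectation of `∫_0^t c(h_k) ∫ f(y) Λ^k(dy|h_k, u - T_k) I{T_k < u < T_{k+1}} du`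
(`lintegral_jump_le`).

Taking `c = 1`, `f = I_Γ` expresses the probability that jump `k+1` lands in `Γ` by time `t` through
the inflow during sojourn `k`. Taking `c = I_Γ(x_k)`, `f = 1` expresses the probability that `Γ` is
left at jump `k+1` by time `t` through the outflow. A visit begun by time `t` either is still in
progress at `t` or has ended. Summing over `k` and shifting the index in the arrivals gives `P(ξ_t ∈
Γ) + outflow = I{x ∈ Γ} + inflow` in `[0,∞]` (`lawAt_add_expectedOutflow`), with no assumption on
explosion. Predictability is what allows the policy during sojourn `k` to be read as a function of
`h_k` and the elapsed time (`act_eq_actHist`).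

It remains to show that the outflow is finite; the inflow is then finite too and the equation can be
rearranged. In (a) the exit rate is bounded on `Γ`, and time is bounded by `t`. In (b) the exit rate
is at most `L w`, so a bound on `E w(ξ_u)` for `u ≤ t` suffices (`tsum_expectedStay_weight_le`). For
this the same balance is used with the truncated weight `min(w, l)` and finitely many sojourns: the
truncation keeps the drift inequality, all quantities to be cancelled are finite, and Grönwall's
inequality yields a bound free of the truncation level and of the number of sojourns. -/

/-! ### Sample paths, and predictable policies as functions of the finite history -/

theorem jumpTime_succ (s : ℕ → Step S) (m : ℕ) :
    jumpTime s (m + 1) = jumpTime s m + (s (m + 1)).1 :=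
  Finset.sum_range_succ _ _

theorem jumpTime_mono (s : ℕ → Step S) : Monotone (jumpTime s) :=
  monotone_nat_of_le_succ fun m => by rw [jumpTime_succ]; exact le_self_add

theorem jumpTime_congr {s s' : ℕ → Step S} {k : ℕ} (h : ∀ i ≤ k, s i = s' i) :
    jumpTime s k = jumpTime s' k :=
  Finset.sum_congr rfl fun i hi => by rw [h i (Nat.lt_succ_iff.1 (Finset.mem_range.1 hi))]

theorem extend_frestrictLe (s : ℕ → Step S) {k i : ℕ} (hi : i ≤ k) :
    extend k (Preorder.frestrictLe k s) i = s i := by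
  simp [extend, hi]

/-- The set of times strictly between the `k`-th and the next jump. -/
def sojourn (s : ℕ → Step S) (k : ℕ) : Set ℝ≥0∞ := Ioo (jumpTime s k) (jumpTime s (k + 1))

theorem jumpTime_extend (s : ℕ → Step S) (k : ℕ) :
    jumpTime (extend k (Preorder.frestrictLe k s)) k = jumpTime s k :=
  jumpTime_congr fun _ hi => extend_frestrictLe s hi

theorem jumpTime_extend_succ (k : ℕ) (h : Hist S k) : jumpTime (extend k h) (k + 1) = ⊤ := by
  rw [jumpTime_succ]
  simp [extend]

theorem IsPath.extend {s : ℕ → Step S} (hs : IsPath s) (k : ℕ) :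
    IsPath (extend k (Preorder.frestrictLe k s)) where
  sojourn_zero := by rw [extend_frestrictLe s (Nat.zero_le k)]; exact hs.1
  state_zero := by rw [extend_frestrictLe s (Nat.zero_le k)]; exact hs.2
  step m := by
    rcases le_or_gt (m + 1) k with hm | hm
    · rw [extend_frestrictLe s hm, extend_frestrictLe s ((Nat.le_succ m).trans hm)]
      exact hs.3 m
    · right
      simp [KitaevCTMDP.extend, not_le.2 hm]

theorem pairwise_disjoint_Ico_jumpTime (s : ℕ → Step S) :
    Pairwise (Function.onFun Disjoint fun k => Ico (jumpTime s k) (jumpTime s (k + 1))) :=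
  (jumpTime_mono s).pairwise_disjoint_on_Ico_succ

variable [MeasurableSpace S] [MeasurableSpace A]

/-- Up to time `v`, two paths that share their first `k` steps and make the next jump after `v` have
the same history. -/
theorem mem_iff_of_history {v : ℝ≥0} {E : Set (Path S)} (hE : MeasurableSet[history S v] E)
    {ω ω' : Path S} {k : ℕ} (hag : ∀ i ≤ k, ω.1 i = ω'.1 i)
    (h1 : v < jumpTime ω.1 (k + 1)) (h2 : v < jumpTime ω'.1 (k + 1)) : ω ∈ E ↔ ω' ∈ E := by
  induction E, hE using MeasurableSpace.generateFrom_induction with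
  | hC E hE _ =>
    obtain ⟨Γ, -, r, hr, m, rfl⟩ := hE
    have hr' : (r : ℝ≥0∞) ≤ v := by exact_mod_cast hr
    rcases le_or_gt m k with hm | hm
    · have := jumpTime_congr (k := m) fun i hi => hag i (hi.trans hm)
      simp only [mem_ofPred_eq, this, hag m hm]
    -- A jump with number above `k` comes after `v` on both paths, so the generating event fails on
    -- both.
    · have h3 : ¬ jumpTime ω.1 m ≤ r := fun h =>
        absurd ((jumpTime_mono ω.1 hm).trans (h.trans hr')) (not_le.2 h1)
      have h4 : ¬ jumpTime ω'.1 m ≤ r := fun h =>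
        absurd ((jumpTime_mono ω'.1 hm).trans (h.trans hr')) (not_le.2 h2)
      simp only [mem_ofPred_eq, h3, h4, false_and]
  | empty => simp
  | compl t _ ih => simp only [mem_compl_iff, ih]
  | iUnion f _ ih => simp only [mem_iUnion, ih]

/-- `ℱ_{u-}` only involves times strictly before `u`, so a next jump exactly at `u` is harmless and
the inequalities may be weak. -/
theorem mem_iff_of_historyPre {u : ℝ≥0} {E : Set (Path S)} (hE : MeasurableSet[historyPre S u] E)
    {ω ω' : Path S} {k : ℕ} (hag : ∀ i ≤ k, ω.1 i = ω'.1 i)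
    (h1 : u ≤ jumpTime ω.1 (k + 1)) (h2 : u ≤ jumpTime ω'.1 (k + 1)) : ω ∈ E ↔ ω' ∈ E := by
  rw [historyPre, MeasurableSpace.measurableSet_iSup] at hE
  induction E, hE using MeasurableSpace.generateFrom_induction with
  | hC E hE _ =>
    obtain ⟨⟨v, hv⟩, hE⟩ := hE
    have hv' : (v : ℝ≥0∞) < u := by exact_mod_cast hv
    exact mem_iff_of_history hE hag (hv'.trans_le h1) (hv'.trans_le h2)
  | empty => simp
  | compl t _ ih => simp only [mem_compl_iff, ih]
  | iUnion f _ ih => simp only [mem_iUnion, ih]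

/-- For `u > 0` the generators `Γ × {0}` do not matter, and a generator `Γ × (r,∞)` with `r < u` is
governed by `ℱ_{r-}`, which cannot separate the two paths. -/
theorem mem_iff_of_predictable {E : Set (Path S × ℝ≥0)}
    (hE : MeasurableSet[predictableSigma S] E)
    {ω ω' : Path S} {k : ℕ} (hag : ∀ i ≤ k, ω.1 i = ω'.1 i) {u : ℝ≥0} (h0 : 0 < u)
    (h1 : u ≤ jumpTime ω.1 (k + 1)) (h2 : u ≤ jumpTime ω'.1 (k + 1)) :
    (ω, u) ∈ E ↔ (ω', u) ∈ E := by
  induction E, hE using MeasurableSpace.generateFrom_induction with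
  | hC E hE _ =>
    rcases hE with ⟨Γ, -, rfl⟩ | ⟨r, Γ, hΓ, rfl⟩
    · simp [h0.ne']
    · by_cases hr : r < u
      · have hr' : (r : ℝ≥0∞) ≤ u := by exact_mod_cast hr.le
        simp [hr, mem_iff_of_historyPre hΓ hag (hr'.trans h1) (hr'.trans h2)]
      · simp [hr]
  | empty => simp
  | compl t _ ih => simp only [mem_compl_iff, ih]
  | iUnion f _ ih => simp only [mem_iUnion, ih]

/-- The path `ω` is compared with the one that copies its first `k` steps and then never jumps: both
make their next jump no earlier than `u`, so a predictable function takes the same value on them. -/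
theorem Policy.act_eq_actHist {M : CTMDP S A} (π : Policy M) (ω : Path S) {k : ℕ} {u : ℝ}
    (hu : ENNReal.ofReal u ∈ sojourn ω.1 k) :
    π.act ω u.toNNReal =
      π.actHist k (Preorder.frestrictLe k ω.1) (u - (jumpTime ω.1 k).toReal) := by
  have hT : jumpTime ω.1 k ≠ ⊤ := hu.1.ne_top
  have hu0 : 0 < u := ENNReal.ofReal_pos.1 (bot_le.trans_lt hu.1)
  have hle : (jumpTime ω.1 k).toReal ≤ u :=
    ENNReal.toReal_le_of_le_ofReal hu0.le hu.1.le
  have htime : (jumpTime ω.1 k).toNNReal + (u - (jumpTime ω.1 k).toReal).toNNReal =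
      u.toNNReal := by
    rw [← NNReal.coe_inj]
    simp only [NNReal.coe_add, Real.coe_toNNReal _ hu0.le,
      Real.coe_toNNReal _ (sub_nonneg.2 hle)]
    simp [ENNReal.coe_toNNReal_eq_toReal]
  rw [Policy.actHist, jumpTime_extend, htime, Policy.actSeq, dif_pos (ω.2.extend k)]
  ext B hB
  -- The set where `π.act` gives `B` the same mass as at `(ω, u)` is predictable and contains `(ω,
  -- u)`.
  have hm := π.act_predictable B hB (measurableSet_singleton (π.act ω u.toNNReal B))
  have := mem_iff_of_predictable hm (ω := ω) (ω' := ⟨_, ω.2.extend k⟩)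
    (fun i hi => (extend_frestrictLe ω.1 hi).symm) (u := u.toNNReal) (Real.toNNReal_pos.2 hu0)
    hu.2.le (by rw [jumpTime_extend_succ]; exact le_top)
  exact (this.1 rfl).symm

theorem xi_eq_of_mem_Ico {t : ℝ≥0} {ω : Path S} {k : ℕ}
    (hk : (t : ℝ≥0∞) ∈ Ico (jumpTime ω.1 k) (jumpTime ω.1 (k + 1))) : xi t ω = (ω.1 k).2 := by
  classical
  have h : ∃ m, jumpTime ω.1 m ≤ t ∧ t < jumpTime ω.1 (m + 1) := ⟨k, hk⟩
  rw [xi, dif_pos h]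
  have hf := Nat.find_spec h
  rcases lt_trichotomy (Nat.find h) k with hlt | heq | hgt
  · exact absurd (((jumpTime_mono ω.1 hlt).trans hk.1).trans_lt hf.2) (lt_irrefl _)
  · convert rfl
    exact heq.symm
  · exact absurd (((jumpTime_mono ω.1 hgt).trans hf.1).trans_lt hk.2) (lt_irrefl _)

theorem xi_eq_cemetery {t : ℝ≥0} {ω : Path S}
    (h : ∀ k, (t : ℝ≥0∞) ∉ Ico (jumpTime ω.1 k) (jumpTime ω.1 (k + 1))) :
    xi t ω = cemetery := by
  rw [xi, dif_neg]
  rintro ⟨m, hm⟩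
  exact h m hm

/-- Functions of the current state, as sums over the periods between jumps. -/
theorem eq_tsum_indicator_Ico {F : WithCemetery S → ℝ≥0∞} (hF : F cemetery = 0) (t : ℝ≥0)
    (ω : Path S) : F (xi t ω) =
      ∑' k, (Ico (jumpTime ω.1 k) (jumpTime ω.1 (k + 1))).indicator
        (fun _ => F (ω.1 k).2) (t : ℝ≥0∞) := by
  by_cases h : ∃ k, (t : ℝ≥0∞) ∈ Ico (jumpTime ω.1 k) (jumpTime ω.1 (k + 1))
  · obtain ⟨k, hk⟩ := h
    rw [tsum_eq_single k, indicator_of_mem hk, xi_eq_of_mem_Ico hk]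
    intro j hj
    exact indicator_of_notMem
      (fun hj' => (pairwise_disjoint_Ico_jumpTime ω.1 hj).le_bot ⟨hj', hk⟩) _
  · push Not at h
    rw [xi_eq_cemetery h, hF]
    simp [indicator_of_notMem (h _)]

/-! ### The law of one step and the compensator of a jump -/

section

variable [StandardBorelSpace S]

namespace Policy

variable {M : CTMDP S A} (π : Policy M)

theorem lintegral_stepLaw (k : ℕ) (h : Hist S k) {G : Step S → ℝ≥0∞} (hG : Measurable G) :
    ∫⁻ z, G z ∂π.stepLaw k h = (∫⁻ u in Ioi (0 : ℝ), EReal.exp (-(π.hazard k h u : EReal)) *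
        ∫⁻ y, G (ENNReal.ofReal u, Sum.inl y) ∂π.intensity k h u) +
      EReal.exp (-(π.totalHazard k h : EReal)) * G (⊤, cemetery) := by
  rw [stepLaw, lintegral_add_measure, Measure.lintegral_bind
    (π.measurable_stepDensity_left k h).aemeasurable hG.aemeasurable, lintegral_smul_measure,
    lintegral_dirac' _ hG]
  congr 1
  refine lintegral_congr fun u => ?_
  rw [lintegral_smul_measure, lintegral_map hG (measurable_const.prodMk measurable_inl)]
  rfl

/-- The survival function of the sojourn time. -/
theorem stepLaw_lt_sojournTime (k : ℕ) (h : Hist S k) {v : ℝ} (hv : 0 ≤ v) :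
    π.stepLaw k h {z | ENNReal.ofReal v < z.1} = EReal.exp (-(π.hazard k h v : EReal)) := by
  obtain ⟨C, hC, hle⟩ := π.intensity_univ_le k h
  have hm : Measurable fun u => π.intensity k h u univ :=
    Measurable.of_uncurry_left (f := fun h u => π.intensity k h u univ)
      (π.measurable_intensity_univ k)
  have hE : MeasurableSet {z : Step S | ENNReal.ofReal v < z.1} :=
    measurableSet_lt measurable_const measurable_fst
  have hP : IsProbabilityMeasure (π.stepLaw k h) := ⟨π.stepLaw_univ k h⟩
  have h1 : π.stepLaw k h {z | ENNReal.ofReal v < z.1}ᶜ =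
      ∫⁻ u in Ioc 0 v, EReal.exp (-(π.hazard k h u : EReal)) * π.intensity k h u univ := by
    rw [π.stepLaw_apply k h hE.compl, Measure.dirac_apply' _ hE.compl]
    simp only [mem_compl_iff, mem_ofPred_eq, ENNReal.ofReal_lt_top, not_true_eq_false,
      not_false_eq_true, indicator_of_notMem, mul_zero, add_zero, not_lt]
    rw [← lintegral_indicator measurableSet_Ioi, ← lintegral_indicator measurableSet_Ioc]
    refine lintegral_congr fun u => ?_
    by_cases hu : 0 < u
    · by_cases huv : u ≤ v
      · rw [indicator_of_mem (mem_Ioi.2 hu), indicator_of_mem (mem_Ioc.2 ⟨hu, huv⟩)]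
        simp [ENNReal.ofReal_le_ofReal huv]
      · rw [indicator_of_mem (mem_Ioi.2 hu), indicator_of_notMem fun h => huv h.2]
        simp [ENNReal.ofReal_le_ofReal_iff hv, huv]
    · rw [indicator_of_notMem (s := Ioi 0) hu, indicator_of_notMem fun h => hu h.1]
  have h2 := lintegral_hazard_Ioc hm hC hle hv
  have h3 := prob_add_prob_compl (μ := π.stepLaw k h) hE
  rw [h1] at h3
  rw [← h3, add_comm] at h2
  -- The event and its complement have total mass one, and so do the exponential and the integrated
  -- density; the common finite mass of sojourns of length at most `v` cancels.
  refine (ENNReal.add_left_inj (ne_top_of_le_ne_top ENNReal.one_ne_top ?_)).1 h2.symm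
  rw [← h1]
  exact prob_le_one

/-- The density of the next jump at absolute time `u` is the probability of having survived past `u`
times the jump intensity at `u`. The rest is the change of variable from sojourn time `v` to `u = T
+ v`; for `T = ⊤` both sides vanish. -/
theorem lintegral_stepLaw_of_add_le (k : ℕ) (h : Hist S k) (T : ℝ≥0∞) (t : ℝ≥0)
    {f : S → ℝ≥0∞} (hf : Measurable f) :
    ∫⁻ z, {z : Step S | T + z.1 ≤ t}.indicator (fun z => Sum.elim f 0 z.2) z ∂π.stepLaw k h =
      ∫⁻ u in Ioc (0 : ℝ) t, {u : ℝ | T < ENNReal.ofReal u}.indicator (fun u =>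
        π.stepLaw k h {z | ENNReal.ofReal u < T + z.1} *
          ∫⁻ y, f y ∂π.intensity k h (u - T.toReal)) u := by
  by_cases hT : T = ⊤
  · simp [hT]
  lift T to ℝ≥0 using hT
  have hF : Measurable (Sum.elim f 0 : WithCemetery S → ℝ≥0∞) := hf.sumElim measurable_const
  have hE : MeasurableSet {z : Step S | T + z.1 ≤ t} :=
    measurableSet_le (measurable_fst.const_add _) measurable_const
  have hG : Measurable fun z : Step S => Sum.elim f 0 z.2 := hF.comp measurable_snd
  rw [π.lintegral_stepLaw k h (hG.indicator hE)]
  have h0 : (⊤, cemetery) ∉ {z : Step S | (T : ℝ≥0∞) + z.1 ≤ t} := by simp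
  rw [indicator_of_notMem h0, mul_zero, add_zero]
  -- The integrand in sojourn time, cut at `t - T`. This is a difference of real numbers, so for `t
  -- < T` the interval is empty.
  set φ : ℝ → ℝ≥0∞ := (Ioc (0 : ℝ) (t - T)).indicator fun v =>
    EReal.exp (-(π.hazard k h v : EReal)) * ∫⁻ y, f y ∂π.intensity k h v with hφ
  trans ∫⁻ v, φ v
  · rw [← lintegral_indicator measurableSet_Ioi]
    refine lintegral_congr fun v => ?_
    by_cases hv : 0 < v
    · have hiff : (T : ℝ≥0∞) + ENNReal.ofReal v ≤ t ↔ v ≤ t - T := by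
        rw [← ENNReal.ofReal_coe_nnreal (p := T), ← ENNReal.ofReal_coe_nnreal (p := t),
          ← ENNReal.ofReal_add T.coe_nonneg hv.le, ENNReal.ofReal_le_ofReal_iff t.coe_nonneg,
            le_sub_iff_add_le']
      rw [indicator_of_mem (mem_Ioi.2 hv)]
      by_cases hvt : v ≤ t - T
      · rw [hφ, indicator_of_mem (mem_Ioc.2 ⟨hv, hvt⟩)]
        simp [indicator, hiff.2 hvt]
      · rw [hφ, indicator_of_notMem fun h => hvt h.2]
        simp [indicator, hiff, hvt]
    · rw [hφ, indicator_of_notMem (s := Ioi 0) hv, indicator_of_notMem fun h => hv h.1]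
  -- Lebesgue measure is translation invariant: replace `v` by `u - T`.
  · rw [← lintegral_sub_right_eq_self φ (T : ℝ), ← lintegral_indicator measurableSet_Ioc]
    refine lintegral_congr fun u => ?_
    by_cases hu : u ∈ Ioc (0 : ℝ) t ∧ (T : ℝ) < u
    · have h1 : u ∈ {u : ℝ | (T : ℝ≥0∞) < ENNReal.ofReal u} := by
        rw [mem_ofPred_eq, ← ENNReal.ofReal_coe_nnreal (p := T)]
        exact (ENNReal.ofReal_lt_ofReal_iff hu.1.1).2 hu.2
      have h2 : u - T ∈ Ioc (0 : ℝ) (t - T) := ⟨sub_pos.2 hu.2, sub_le_sub_right hu.1.2 _⟩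
      have h3 : {z : Step S | ENNReal.ofReal u < T + z.1} =
          {z | ENNReal.ofReal (u - T) < z.1} := by
        ext z
        have : ENNReal.ofReal u = T + ENNReal.ofReal (u - T) := by
          rw [← ENNReal.ofReal_coe_nnreal (p := T), ← ENNReal.ofReal_add T.coe_nonneg h2.1.le]
          ring_nf
        rw [mem_ofPred_eq, mem_ofPred_eq, this,
          ENNReal.add_lt_add_iff_left ENNReal.coe_ne_top]
      rw [hφ, indicator_of_mem h2, indicator_of_mem hu.1, indicator_of_mem h1, h3,
        π.stepLaw_lt_sojournTime k h h2.1.le, ENNReal.coe_toReal]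
    · rw [hφ, indicator_of_notMem (s := Ioc (0 : ℝ) (t - T))]
      · by_cases hu1 : u ∈ Ioc (0 : ℝ) t
        · have h1 : u ∉ {u : ℝ | (T : ℝ≥0∞) < ENNReal.ofReal u} := by
            rw [mem_ofPred_eq, ← ENNReal.ofReal_coe_nnreal (p := T),
              ENNReal.ofReal_lt_ofReal_iff hu1.1]
            exact fun h => hu ⟨hu1, h⟩
          rw [indicator_of_mem hu1, indicator_of_notMem h1]
        · rw [indicator_of_notMem hu1]
      · rintro ⟨h1, h2⟩
        have hTu := sub_pos.1 h1
        exact hu ⟨⟨T.2.trans_lt hTu, (sub_le_sub_iff_right _).1 h2⟩, hTu⟩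

theorem lintegral_traj_succ (k : ℕ) (h₀ : Hist S 0) {G : Hist S k × Step S → ℝ≥0∞}
    (hG : Measurable G) :
    ∫⁻ s, G (Preorder.frestrictLe k s, s (k + 1))
        ∂Kernel.traj (X := fun _ => Step S) π.stepKernel 0 h₀ =
      ∫⁻ h, ∫⁻ z, G (h, z) ∂π.stepLaw k h
        ∂Kernel.partialTraj (X := fun _ => Step S) π.stepKernel 0 k h₀ := by
  have h1 := Kernel.partialTraj_compProd_eq_map_traj (X := fun _ => Step S) (κ := π.stepKernel)
    (Nat.zero_le k) (x₀ := h₀)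
  rw [← lintegral_map (f := G) (g := fun s : ℕ → Step S => (Preorder.frestrictLe k s, s (k + 1)))
    hG ((Preorder.measurable_frestrictLe k).prodMk (measurable_pi_apply _)), ← h1,
    Measure.lintegral_compProd hG]
  rfl

theorem measurable_lintegral_intensity (k : ℕ) {f : S → ℝ≥0∞} (hf : Measurable f) :
    Measurable fun p : Hist S k × ℝ => ∫⁻ y, f y ∂π.intensity k p.1 p.2 :=
  (Measure.measurable_lintegral hf).comp (π.measurable_intensity k)

/-- The last jump time of a finite history. -/
def lastTime (k : ℕ) (h : Hist S k) : ℝ≥0∞ := jumpTime (extend k h) k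

omit [StandardBorelSpace S] in
theorem measurable_lastTime (k : ℕ) : Measurable (lastTime (S := S) k) :=
  (measurable_jumpTime k).comp (measurable_extend k)

/-- `c(h_k) ∫ f(y) Λ^k(dy|h_k, u - T_k)` on the event that `u` lies between the `k`-th and the next
jump. -/
def jumpDensity (k : ℕ) (c : Hist S k → ℝ≥0∞) (f : S → ℝ≥0∞) (s : ℕ → Step S) (u : ℝ) : ℝ≥0∞ :=
  (sojourn s k).indicator (fun _ => c (Preorder.frestrictLe k s) *
    ∫⁻ y, f y ∂π.intensity k (Preorder.frestrictLe k s) (u - (jumpTime s k).toReal))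
    (ENNReal.ofReal u)

omit [StandardBorelSpace S] in
theorem measurableSet_sojourn (k : ℕ) :
    MeasurableSet {p : (ℕ → Step S) × ℝ | ENNReal.ofReal p.2 ∈ sojourn p.1 k} :=
  (measurableSet_lt ((measurable_jumpTime k).comp measurable_fst)
    measurable_snd.ennreal_ofReal).inter (measurableSet_lt measurable_snd.ennreal_ofReal
      ((measurable_jumpTime (k + 1)).comp measurable_fst))

theorem measurable_jumpDensity (k : ℕ) {c : Hist S k → ℝ≥0∞} (hc : Measurable c)
    {f : S → ℝ≥0∞} (hf : Measurable f) :
    Measurable fun p : (ℕ → Step S) × ℝ => π.jumpDensity k c f p.1 p.2 := by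
  have h1 : Measurable fun p : (ℕ → Step S) × ℝ => (Preorder.frestrictLe k p.1 : Hist S k) :=
    (Preorder.measurable_frestrictLe k).comp measurable_fst
  have h2 : Measurable fun p : (ℕ → Step S) × ℝ => p.2 - (jumpTime p.1 k).toReal :=
    measurable_snd.sub ((measurable_jumpTime k).comp measurable_fst).ennreal_toReal
  have h3 := Measurable.comp (π.measurable_lintegral_intensity k hf) (h1.prodMk h2)
  have h4 := (Measurable.comp hc h1).mul h3
  exact h4.indicator (measurableSet_sojourn k)

/-- The conditional expectation of `jumpDensity` given `h_k`. -/
def histDensity (k : ℕ) (f : S → ℝ≥0∞) (h : Hist S k) (u : ℝ) : ℝ≥0∞ :=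
  {u : ℝ | lastTime k h < ENNReal.ofReal u}.indicator (fun u =>
    π.stepLaw k h {z | ENNReal.ofReal u < lastTime k h + z.1} *
      ∫⁻ y, f y ∂π.intensity k h (u - (lastTime k h).toReal)) u

theorem measurable_lintegral_intensity_sub (k : ℕ) {f : S → ℝ≥0∞} (hf : Measurable f) :
    Measurable fun p : Hist S k × ℝ =>
      ∫⁻ y, f y ∂π.intensity k p.1 (p.2 - (lastTime k p.1).toReal) := by
  have h1 : Measurable fun p : Hist S k × ℝ => lastTime k p.1 :=
    (measurable_lastTime k).comp measurable_fst
  have h2 : Measurable fun p : Hist S k × ℝ => (p.1, p.2 - (lastTime k p.1).toReal) :=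
    measurable_fst.prodMk (measurable_snd.sub h1.ennreal_toReal)
  have h3 := Measurable.comp (π.measurable_lintegral_intensity k hf) h2
  simpa only [Function.comp_def] using h3

theorem measurable_histDensity (k : ℕ) {f : S → ℝ≥0∞} (hf : Measurable f) :
    Measurable fun p : Hist S k × ℝ => π.histDensity k f p.1 p.2 := by
  have h1 : Measurable fun p : Hist S k × ℝ => lastTime k p.1 :=
    (measurable_lastTime k).comp measurable_fst
  have hE : MeasurableSet {q : (Hist S k × ℝ) × Step S |
      ENNReal.ofReal q.1.2 < lastTime k q.1.1 + q.2.1} :=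
    measurableSet_lt (measurable_snd.comp measurable_fst).ennreal_ofReal
      ((h1.comp measurable_fst).add (measurable_fst.comp measurable_snd))
  have h3 := Kernel.measurable_kernel_prodMk_left
    (κ := (π.stepKernel k).comap (Prod.fst : Hist S k × ℝ → Hist S k) measurable_fst) hE
  have h4 := h3.mul (π.measurable_lintegral_intensity_sub k hf)
  exact h4.indicator (measurableSet_lt h1 measurable_snd.ennreal_ofReal)

/-- Conditioning on `h_k` takes `c(h_k)` outside and leaves the one-step identity with `T = T_k`. -/
theorem lintegral_indicator_jumpTime_le (k : ℕ) (h₀ : Hist S 0) (t : ℝ≥0)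
    {c : Hist S k → ℝ≥0∞} (hc : Measurable c) {f : S → ℝ≥0∞} (hf : Measurable f) :
    ∫⁻ s, {s : ℕ → Step S | jumpTime s (k + 1) ≤ t}.indicator
        (fun s => c (Preorder.frestrictLe k s) * Sum.elim f 0 (s (k + 1)).2) s
        ∂Kernel.traj (X := fun _ => Step S) π.stepKernel 0 h₀ =
      ∫⁻ h, c h * (∫⁻ u in Ioc (0 : ℝ) t, π.histDensity k f h u)
        ∂Kernel.partialTraj (X := fun _ => Step S) π.stepKernel 0 k h₀ := by
  have hF : Measurable (Sum.elim f 0 : WithCemetery S → ℝ≥0∞) := hf.sumElim measurable_const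
  have hJ : Measurable fun p : Hist S k × Step S => lastTime k p.1 :=
    (measurable_lastTime k).comp measurable_fst
  have hE : MeasurableSet {p : Hist S k × Step S | lastTime k p.1 + p.2.1 ≤ t} :=
    measurableSet_le (hJ.add (measurable_fst.comp measurable_snd)) measurable_const
  have hFs : Measurable fun p : Hist S k × Step S => Sum.elim f 0 p.2.2 :=
    hF.comp (measurable_snd.comp measurable_snd)
  have hcs : Measurable fun p : Hist S k × Step S => c p.1 := hc.comp measurable_fst
  have h1 := π.lintegral_traj_succ k h₀ ((hcs.mul hFs).indicator hE)
  refine Eq.trans (lintegral_congr fun s => ?_) (h1.trans (lintegral_congr fun h => ?_))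
  · simp only [indicator, mem_ofPred_eq, lastTime, jumpTime_extend, jumpTime_succ, Pi.mul_apply]
  · rw [show ∫⁻ u in Ioc (0 : ℝ) t, π.histDensity k f h u = _ from
      (π.lintegral_stepLaw_of_add_le k h (lastTime k h) t hf).symm, ← lintegral_const_mul]
    · refine lintegral_congr fun z => ?_
      simp only [indicator, mem_ofPred_eq, Pi.mul_apply]
      split_ifs <;> simp
    · exact (hF.comp measurable_snd).indicator
        (measurableSet_le (measurable_fst.const_add _) measurable_const)

/-- Given `h_k` with `T_k < u`, only the event `u < T_{k+1}` is still random; its conditional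
probability is the survival factor in `histDensity`. -/
theorem lintegral_jumpDensity (k : ℕ) (h₀ : Hist S 0) (u : ℝ)
    {c : Hist S k → ℝ≥0∞} (hc : Measurable c) {f : S → ℝ≥0∞} (hf : Measurable f) :
    ∫⁻ s, π.jumpDensity k c f s u
        ∂Kernel.traj (X := fun _ => Step S) π.stepKernel 0 h₀ =
      ∫⁻ h, c h * π.histDensity k f h u
        ∂Kernel.partialTraj (X := fun _ => Step S) π.stepKernel 0 k h₀ := by
  have hJ : Measurable fun p : Hist S k × Step S => lastTime k p.1 :=
    (measurable_lastTime k).comp measurable_fst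
  have hE : MeasurableSet {p : Hist S k × Step S |
      ENNReal.ofReal u ∈ Ioo (lastTime k p.1) (lastTime k p.1 + p.2.1)} :=
    (measurableSet_lt hJ measurable_const).inter
      (measurableSet_lt measurable_const (hJ.add (measurable_fst.comp measurable_snd)))
  have hcs : Measurable fun p : Hist S k × Step S => c p.1 := hc.comp measurable_fst
  have hpu : Measurable fun p : Hist S k × Step S => (p.1, u) :=
    measurable_fst.prodMk measurable_const
  have hfs := Measurable.comp (π.measurable_lintegral_intensity_sub k hf) hpu
  have h1 := π.lintegral_traj_succ k h₀ ((hcs.mul hfs).indicator hE)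
  refine Eq.trans (lintegral_congr fun s => ?_) (h1.trans (lintegral_congr fun h => ?_))
  · simp only [jumpDensity, indicator, mem_ofPred_eq, lastTime, jumpTime_extend, jumpTime_succ,
      sojourn, Pi.mul_apply, Function.comp_apply]
  · by_cases hu : lastTime k h < ENNReal.ofReal u
    · have hE' : MeasurableSet {z : Step S | ENNReal.ofReal u < lastTime k h + z.1} :=
        measurableSet_lt measurable_const (measurable_fst.const_add _)
      rw [histDensity, indicator_of_mem (show u ∈ {u : ℝ | lastTime k h < ENNReal.ofReal u}
        from hu), mul_left_comm, mul_comm (π.stepLaw k h _), ← lintegral_indicator_const hE']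
      refine lintegral_congr fun z => ?_
      simp only [indicator, mem_ofPred_eq, mem_Ioo, hu, true_and, Pi.mul_apply,
        Function.comp_apply]
    · simp [indicator, hu, histDensity]

/-- The compensator of the `(k+1)`-st jump. -/
theorem lintegral_jump_le (k : ℕ) (h₀ : Hist S 0) (t : ℝ≥0) {c : Hist S k → ℝ≥0∞}
    (hc : Measurable c) {f : S → ℝ≥0∞} (hf : Measurable f) :
    ∫⁻ s, {s : ℕ → Step S | jumpTime s (k + 1) ≤ t}.indicator
        (fun s => c (Preorder.frestrictLe k s) * Sum.elim f 0 (s (k + 1)).2) s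
        ∂Kernel.traj (X := fun _ => Step S) π.stepKernel 0 h₀ =
      ∫⁻ u in Ioc (0 : ℝ) t, ∫⁻ s, π.jumpDensity k c f s u
        ∂Kernel.traj (X := fun _ => Step S) π.stepKernel 0 h₀ := by
  have hm := π.measurable_histDensity k hf
  -- Both sides are the integral of `c(h) * histDensity` over `h` and `u`, in the two orders.
  rw [π.lintegral_indicator_jumpTime_le k h₀ t hc hf,
    lintegral_congr fun u => π.lintegral_jumpDensity k h₀ u hc hf, lintegral_lintegral_swap]
  · refine lintegral_congr fun h => ?_
    rw [lintegral_const_mul]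
    exact Measurable.of_uncurry_left (f := π.histDensity k f) hm
  · have h1 : Measurable fun p : ℝ × Hist S k => c p.2 := hc.comp measurable_snd
    exact (h1.mul (Measurable.comp hm measurable_swap)).aemeasurable

end Policy

end

/-! ### Rates along a path and the transfer of the law to sequences -/

/-- There are countably many jump times. Off them the open sojourn intervals, on which the policy is
known, agree with the half-open ones, on which `ξ` is constant. -/
theorem ae_ofReal_ne_jumpTime {S : Type*} (s : ℕ → Step S) :
    ∀ᵐ u ∂volume.restrict (Ioi (0 : ℝ)), ∀ k, ENNReal.ofReal u ≠ jumpTime s k := by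
  have h := (countable_range fun k => (jumpTime s k).toReal).ae_notMem volume
  filter_upwards [ae_restrict_of_ae h, ae_restrict_mem measurableSet_Ioi] with u hu hu0 k hk
  refine hu ⟨k, ?_⟩
  change (jumpTime s k).toReal = u
  rw [← hk, ENNReal.toReal_ofReal (le_of_lt hu0)]

theorem mem_sojourn_iff {S : Type*} {s : ℕ → Step S} {u : ℝ≥0∞} (hu : ∀ k, u ≠ jumpTime s k)
    (k : ℕ) : u ∈ sojourn s k ↔ u ∈ Ico (jumpTime s k) (jumpTime s (k + 1)) :=
  ⟨fun h => ⟨h.1.le, h.2⟩, fun h => ⟨lt_of_le_of_ne h.1 (hu k).symm, h.2⟩⟩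

namespace CTMDP

/-- Conservativeness: `q(S|x,a) = 0` gives `-q({x}|x,a) = q(S \ {x}|x,a)`, and off the graph both
rates are zero. -/
theorem exitRateExt_eq (M : CTMDP S A) [MeasurableSingletonClass S] (x : WithCemetery S)
    (a : WithCemetery A) : M.exitRateExt x a = M.jumpRateExt x a univ := by
  rcases x with x | x
  · rcases a with a | a
    · change ENNReal.ofReal (M.exitRate x a) = M.jumpRate x a univ
      rw [M.jumpRate_apply x a MeasurableSet.univ]
      congr 1
      by_cases ha : a ∈ M.adm x
      · have h1 := VectorMeasure.of_sdiff (v := M.q x a) (measurableSet_singleton x)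
          MeasurableSet.univ (subset_univ _)
        rw [M.q_conservative x a ha] at h1
        rw [h1, exitRate, zero_sub]
      · simp [exitRate, M.q_off_graph x a ha]
    · rfl
  · rfl

end CTMDP

namespace Policy

variable {M : CTMDP S A} (π : Policy M)

/-- Rates at time `u`, as sums over the periods between jumps. -/
theorem ae_lintegral_act_eq_tsum (ω : Path S) {R : WithCemetery S → WithCemetery A → ℝ≥0∞}
    (hR : ∀ a, R cemetery a = 0) :
    ∀ᵐ u ∂volume.restrict (Ioi (0 : ℝ)), ∫⁻ a, R (xi u.toNNReal ω) a ∂π.act ω u.toNNReal =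
      ∑' k, (sojourn ω.1 k).indicator (fun _ => ∫⁻ a, R (ω.1 k).2 a
        ∂π.actHist k (Preorder.frestrictLe k ω.1) (u - (jumpTime ω.1 k).toReal))
        (ENNReal.ofReal u) := by
  filter_upwards [ae_ofReal_ne_jumpTime ω.1] with u hu
  by_cases h : ∃ k, ENNReal.ofReal u ∈ sojourn ω.1 k
  · obtain ⟨k, hk⟩ := h
    have hk' := (mem_sojourn_iff hu k).1 hk
    rw [tsum_eq_single k, indicator_of_mem hk, xi_eq_of_mem_Ico hk', π.act_eq_actHist ω hk]
    intro j hj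
    exact indicator_of_notMem (fun hj' => (pairwise_disjoint_Ico_jumpTime ω.1 hj).le_bot
      ⟨(mem_sojourn_iff hu j).1 hj', hk'⟩) _
  · push Not at h
    -- A time that is neither a jump time nor in a sojourn lies beyond the explosion, where `R`
    -- vanishes.
    rw [xi_eq_cemetery fun k hk => h k ((mem_sojourn_iff hu k).2 hk)]
    simp [indicator_of_notMem (h _), hR]

variable [StandardBorelSpace S]

/-- `P_x^π` on the space of all sequences of steps. -/
def trajAt (x : S) : Measure (ℕ → Step S) :=
  Kernel.traj (X := fun _ => Step S) π.stepKernel 0 fun _ => (0, Sum.inl x)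

instance (x : S) : IsProbabilityMeasure (π.trajAt x) := by
  unfold trajAt; infer_instance

theorem seqLaw_dirac (x : S) : π.seqLaw (Measure.dirac x) = π.trajAt x := by
  rw [seqLaw, Measure.map_dirac' measurable_initHist, Measure.dirac_bind (Kernel.measurable _)]
  rfl

/-- Almost every sequence is a sample path, so restricting the law of the sequence to the sample
paths loses nothing. -/
theorem lintegral_lawAt (x : S) {G : (ℕ → Step S) → ℝ≥0∞} (hG : Measurable G) :
    ∫⁻ ω, G ω.1 ∂π.lawAt x = ∫⁻ s, G s ∂π.trajAt x := by
  have he : MeasurableEmbedding (Subtype.val : Path S → ℕ → Step S) :=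
    MeasurableEmbedding.subtype_coe (measurableSet_isPath (S := S))
  rw [lawAt, law, seqLaw_dirac, ← lintegral_map hG measurable_subtype_coe, he.map_comap,
    Measure.restrict_eq_self_of_ae_mem]
  filter_upwards [π.traj_ae_isPath x] with s hs
  exact ⟨⟨s, hs⟩, rfl⟩

/-! ### The balance of arrivals and departures -/

/-- The expected value of `f(x_k)` on `T_k ≤ t`. -/
def expectedHits (x : S) (t : ℝ≥0) (f : S → ℝ≥0∞) (k : ℕ) : ℝ≥0∞ :=
  ∫⁻ s, {s : ℕ → Step S | jumpTime s k ≤ t}.indicator (fun s => Sum.elim f 0 (s k).2) s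
    ∂π.trajAt x

/-- The expected value of `f(x_k)` on `T_k ≤ t < T_{k+1}`. -/
def expectedStay (x : S) (t : ℝ≥0) (f : S → ℝ≥0∞) (k : ℕ) : ℝ≥0∞ :=
  ∫⁻ s, (Ico (jumpTime s k) (jumpTime s (k + 1))).indicator (fun _ => Sum.elim f 0 (s k).2)
    (t : ℝ≥0∞) ∂π.trajAt x

/-- The expected value of `∫_0^t ∫_S f(y) Λ^k(dy|h_k,u - T_k) I{T_k < u < T_{k+1}} du`. -/
def expectedIn (x : S) (t : ℝ≥0) (f : S → ℝ≥0∞) (k : ℕ) : ℝ≥0∞ :=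
  ∫⁻ u in Ioc (0 : ℝ) t, ∫⁻ s, π.jumpDensity k (fun _ => 1) f s u ∂π.trajAt x

/-- The expected value of `∫_0^t f(x_k) Λ^k(S|h_k,u - T_k) I{T_k < u < T_{k+1}} du`. -/
def expectedOut (x : S) (t : ℝ≥0) (f : S → ℝ≥0∞) (k : ℕ) : ℝ≥0∞ :=
  ∫⁻ u in Ioc (0 : ℝ) t, ∫⁻ s, π.jumpDensity k (fun h => Sum.elim f 0 (lastState k h))
    (fun _ => 1) s u ∂π.trajAt x

variable {f : S → ℝ≥0∞}

omit [StandardBorelSpace S] in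
theorem measurable_lastState (k : ℕ) : Measurable (lastState (S := S) k) :=
  measurable_snd.comp (measurable_pi_apply _)

omit [StandardBorelSpace S] in
theorem measurable_elim_state (hf : Measurable f) (k : ℕ) :
    Measurable fun s : ℕ → Step S => (Sum.elim f 0 : WithCemetery S → ℝ≥0∞) (s k).2 :=
  (hf.sumElim measurable_const).comp (measurable_snd.comp (measurable_pi_apply k))

omit [StandardBorelSpace S] in
theorem measurable_elim_lastState (hf : Measurable f) (k : ℕ) :
    Measurable fun h : Hist S k => (Sum.elim f 0 : WithCemetery S → ℝ≥0∞) (lastState k h) :=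
  (hf.sumElim measurable_const).comp (measurable_lastState k)

theorem expectedHits_zero (x : S) (t : ℝ≥0) (f : S → ℝ≥0∞) : π.expectedHits x t f 0 = f x := by
  have h1 := π.traj_ae_mem 0 (fun _ => (0, Sum.inl x)) (B := {z | z.1 = 0})
    (measurable_fst (measurableSet_singleton 0)) rfl
  have h2 := π.traj_ae_mem 0 (fun _ => (0, Sum.inl x)) (B := {z | z.2 ∈ Sum.inl '' {x}})
    (measurable_snd (measurableSet_singleton x).inl_image) ⟨x, rfl, rfl⟩
  have h3 : (fun s : ℕ → Step S => {s : ℕ → Step S | jumpTime s 0 ≤ t}.indicator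
      (fun s => (Sum.elim f 0 : WithCemetery S → ℝ≥0∞) (s 0).2) s) =ᵐ[π.trajAt x]
        fun _ => f x := by
    filter_upwards [h1, h2] with s hs1 hs2
    obtain ⟨_, rfl, hx⟩ := hs2
    have hs1' : (s 0).1 = 0 := hs1
    have h0 : jumpTime s 0 = 0 := by simp [jumpTime, hs1']
    simp [indicator, h0, ← hx]
  rw [expectedHits, lintegral_congr_ae h3]
  simp

theorem expectedHits_succ (x : S) (t : ℝ≥0) (hf : Measurable f) (k : ℕ) :
    π.expectedHits x t f (k + 1) = π.expectedIn x t f k := by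
  have := π.lintegral_jump_le k (fun _ => (0, Sum.inl x)) t
    (measurable_const (a := (1 : ℝ≥0∞))) hf
  simp only [one_mul] at this
  exact this

/-- A visit that has begun by time `t` is either in progress at `t` or has ended by `t`; the latter
part is the compensator identity with weight `c(h_k) = f(x_k)` and test function `1`. -/
theorem expectedHits_eq (x : S) (t : ℝ≥0) (hf : Measurable f) (k : ℕ) :
    π.expectedHits x t f k = π.expectedStay x t f k + π.expectedOut x t f k := by
  have h1 := π.lintegral_jump_le k (fun _ => (0, Sum.inl x)) t
    (measurable_elim_lastState hf k) (measurable_const (a := (1 : ℝ≥0∞)))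
  have h2 : MeasurableSet {s : ℕ → Step S | (t : ℝ≥0∞) ∈
      Ico (jumpTime s k) (jumpTime s (k + 1))} :=
    (measurableSet_le (measurable_jumpTime k) measurable_const).inter
      (measurableSet_lt measurable_const (measurable_jumpTime (k + 1)))
  have h3 : Measurable fun s : ℕ → Step S => (Ico (jumpTime s k) (jumpTime s (k + 1))).indicator
      (fun _ => (Sum.elim f 0 : WithCemetery S → ℝ≥0∞) (s k).2) (t : ℝ≥0∞) :=
    (measurable_elim_state hf k).indicator h2
  refine Eq.trans ?_ (congrArg (π.expectedStay x t f k + ·) h1)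
  rw [expectedStay, ← trajAt, ← lintegral_add_left h3]
  refine lintegral_congr_ae ?_
  filter_upwards [π.traj_ae_isPath x] with s hs
  by_cases hk : jumpTime s (k + 1) ≤ t
  · have hk' := (jumpTime_mono s k.le_succ).trans hk
    -- The test function is extended by `0` to the cemetery, so a jump by time `t` must be known to
    -- land in `S`; a step to the cemetery has infinite sojourn time.
    have hne : (s (k + 1)).2 ≠ cemetery := by
      intro h
      rcases hs.3 k with h' | h'
      · exact h'.2.1 h
      · rw [jumpTime_succ, h'] at hk
        simp at hk
    obtain ⟨y, hy⟩ : ∃ y, (s (k + 1)).2 = Sum.inl y := by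
      rcases h : (s (k + 1)).2 with y | y
      · exact ⟨y, rfl⟩
      · exact absurd h hne
    simp [indicator, hk, hk', hy, not_lt.2 hk, lastState]
  · have hk2 := not_le.1 hk
    simp [indicator, hk, hk2]

theorem jumpDensity_one_indicator (k : ℕ) {Γ : Set S} (hΓ : MeasurableSet Γ) (s : ℕ → Step S)
    (u : ℝ) : π.jumpDensity k (fun _ => 1) (Γ.indicator 1) s u =
      (sojourn s k).indicator (fun _ => ∫⁻ a, M.jumpRateExt (s k).2 a Γ
        ∂π.actHist k (Preorder.frestrictLe k s) (u - (jumpTime s k).toReal))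
        (ENNReal.ofReal u) := by
  rw [jumpDensity, lintegral_indicator_one hΓ, π.intensity_apply k _ _ hΓ, one_mul]
  rfl

/-- The exit rate is the total mass of the jump rate. Finiteness of `f` lets the factor `f(x_k)`
leave the integral over actions. -/
theorem jumpDensity_state_one (k : ℕ) (hf : ∀ y, f y ≠ ⊤) (s : ℕ → Step S)
    (u : ℝ) : π.jumpDensity k (fun h => Sum.elim f 0 (lastState k h)) (fun _ => 1) s u =
      (sojourn s k).indicator (fun _ => ∫⁻ a, M.exitRateExt (s k).2 a * Sum.elim f 0 (s k).2
        ∂π.actHist k (Preorder.frestrictLe k s) (u - (jumpTime s k).toReal))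
        (ENNReal.ofReal u) := by
  have hF : Sum.elim f 0 (s k).2 ≠ ⊤ := by
    rcases (s k).2 with y | y
    · exact hf y
    · exact ENNReal.zero_ne_top
  simp_rw [lintegral_mul_const' _ _ hF]
  rw [jumpDensity, lintegral_one, π.intensity_apply k _ _ MeasurableSet.univ, mul_comm]
  simp only [M.exitRateExt_eq]
  rfl

theorem lintegral_lawAt_tsum_jumpDensity (x : S) (t : ℝ≥0) {c : ∀ k, Hist S k → ℝ≥0∞}
    (hc : ∀ k, Measurable (c k)) (hf : Measurable f) :
    ∫⁻ ω, ∫⁻ u in Ioc (0 : ℝ) t, ∑' k, π.jumpDensity k (c k) f ω.1 u ∂volume ∂π.lawAt x =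
      ∑' k, ∫⁻ u in Ioc (0 : ℝ) t, ∫⁻ s, π.jumpDensity k (c k) f s u ∂π.trajAt x := by
  have hm := fun k => π.measurable_jumpDensity k (hc k) hf
  have hm1 : ∀ k (s : ℕ → Step S), Measurable (π.jumpDensity k (c k) f s) := fun k s =>
    Measurable.of_uncurry_left (f := π.jumpDensity k (c k) f) (hm k)
  have hm2 : ∀ k, Measurable fun s : ℕ → Step S =>
      ∫⁻ u in Ioc (0 : ℝ) t, π.jumpDensity k (c k) f s u := fun k =>
    (hm k).lintegral_prod_right'
  simp_rw [fun ω : Path S => lintegral_tsum (μ := volume.restrict (Ioc (0 : ℝ) t))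
    fun k => (hm1 k ω.1).aemeasurable]
  rw [π.lintegral_lawAt x (Measurable.tsum hm2),
    lintegral_tsum fun k => (hm2 k).aemeasurable]
  exact tsum_congr fun k => lintegral_lintegral_swap (hm k).aemeasurable

theorem expectedInflow_eq_tsum (x : S) (t : ℝ≥0) {Γ : Set S} (hΓ : MeasurableSet Γ) :
    π.expectedInflow x t Γ = ∑' k, π.expectedIn x t (Γ.indicator 1) k := by
  rw [expectedInflow]
  unfold expectedIn
  rw [← π.lintegral_lawAt_tsum_jumpDensity x t (fun _ => measurable_const)
    (measurable_one.indicator hΓ)]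
  refine lintegral_congr fun ω => lintegral_congr_ae ?_
  have h := π.ae_lintegral_act_eq_tsum ω (R := fun y a => M.jumpRateExt y a Γ) fun a => rfl
  filter_upwards [ae_restrict_of_ae_restrict_of_subset Ioc_subset_Ioi_self h] with u hu
  rw [hu]
  exact tsum_congr fun k => (π.jumpDensity_one_indicator k hΓ ω.1 u).symm

omit [MeasurableSpace S] [StandardBorelSpace S] in
theorem indicator_inl_image (Γ : Set S) (y : WithCemetery S) :
    (Sum.inl '' Γ).indicator 1 y = Sum.elim (Γ.indicator (1 : S → ℝ≥0∞)) 0 y := by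
  rcases y with y | y
  · by_cases hy : y ∈ Γ <;> simp [hy]
  · simp

theorem expectedOutflow_eq_tsum (x : S) (t : ℝ≥0) {Γ : Set S} (hΓ : MeasurableSet Γ) :
    π.expectedOutflow x t Γ = ∑' k, π.expectedOut x t (Γ.indicator 1) k := by
  have hΓ1 : Measurable (Γ.indicator (1 : S → ℝ≥0∞)) := measurable_one.indicator hΓ
  rw [expectedOutflow]
  unfold expectedOut
  rw [← π.lintegral_lawAt_tsum_jumpDensity x t (fun k => measurable_elim_lastState hΓ1 k)
    measurable_const]
  refine lintegral_congr fun ω => lintegral_congr_ae ?_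
  have h := π.ae_lintegral_act_eq_tsum ω (R := fun y a => M.exitRateExt y a *
    Sum.elim (Γ.indicator 1) 0 y) fun a => by simp
  filter_upwards [ae_restrict_of_ae_restrict_of_subset Ioc_subset_Ioi_self h] with u hu
  simp only [indicator_inl_image]
  rw [hu]
  refine tsum_congr fun k => (π.jumpDensity_state_one k (fun y => ?_) ω.1 u).symm
  by_cases hy : y ∈ Γ <;> simp [hy]

theorem lawAt_xi_mem (x : S) (t : ℝ≥0) {Γ : Set S} (hΓ : MeasurableSet Γ) :
    π.lawAt x {ω | xi t ω ∈ Sum.inl '' Γ} = ∑' k, π.expectedStay x t (Γ.indicator 1) k := by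
  have hΓ1 : Measurable (Γ.indicator (1 : S → ℝ≥0∞)) := measurable_one.indicator hΓ
  have hm : ∀ k, Measurable fun s : ℕ → Step S =>
      (Ico (jumpTime s k) (jumpTime s (k + 1))).indicator
      (fun _ => (Sum.elim (Γ.indicator (1 : S → ℝ≥0∞)) 0 : WithCemetery S → ℝ≥0∞) (s k).2)
      (t : ℝ≥0∞) := fun k => by
    refine (measurable_elim_state hΓ1 k).indicator (s := {s : ℕ → Step S | (t : ℝ≥0∞) ∈
      Ico (jumpTime s k) (jumpTime s (k + 1))}) ?_
    exact (measurableSet_le (measurable_jumpTime k) measurable_const).inter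
      (measurableSet_lt measurable_const (measurable_jumpTime (k + 1)))
  have h1 : ∀ ω : Path S, {ω | xi t ω ∈ Sum.inl '' Γ}.indicator (1 : Path S → ℝ≥0∞) ω =
      ∑' k, (Ico (jumpTime ω.1 k) (jumpTime ω.1 (k + 1))).indicator
      (fun _ => (Sum.elim (Γ.indicator (1 : S → ℝ≥0∞)) 0 : WithCemetery S → ℝ≥0∞) (ω.1 k).2)
      (t : ℝ≥0∞) := fun ω => by
    rw [← eq_tsum_indicator_Ico (by simp) t ω, ← indicator_inl_image]
    rfl
  -- The indicator of the event is a countable sum of measurable functions of the steps, hence the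
  -- event is measurable.
  have h2 : MeasurableSet {ω : Path S | xi t ω ∈ Sum.inl '' Γ} := by
    have h3 : Measurable ({ω : Path S | xi t ω ∈ Sum.inl '' Γ}.indicator (1 : Path S → ℝ≥0∞)) := by
      rw [funext h1]
      exact Measurable.tsum fun k => (hm k).comp measurable_subtype_coe
    exact (measurable_indicator_const_iff (1 : ℝ≥0∞)).1 h3
  rw [← lintegral_indicator_one h2, lintegral_congr h1,
    π.lintegral_lawAt x (Measurable.tsum hm),
    lintegral_tsum fun k => (hm k).aemeasurable]
  rfl

/-- The forward equation, as an equation between possibly infinite quantities. -/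
theorem lawAt_add_expectedOutflow (x : S) (t : ℝ≥0) {Γ : Set S} (hΓ : MeasurableSet Γ) :
    π.lawAt x {ω | xi t ω ∈ Sum.inl '' Γ} + π.expectedOutflow x t Γ =
      Γ.indicator 1 x + π.expectedInflow x t Γ := by
  have hΓ1 : Measurable (Γ.indicator (1 : S → ℝ≥0∞)) := measurable_one.indicator hΓ
  rw [π.lawAt_xi_mem x t hΓ, π.expectedOutflow_eq_tsum x t hΓ, π.expectedInflow_eq_tsum x t hΓ,
    ← ENNReal.tsum_add, ← tsum_congr fun k => π.expectedHits_eq x t hΓ1 k,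
    -- Splitting off the visit that begins at time `0` gives the initial term; the visit with number
    -- `k + 1` begins by a jump out of sojourn `k`.
    tsum_eq_zero_add' ENNReal.summable, expectedHits_zero]
  simp only [π.expectedHits_succ x t hΓ1]

/-- A probability is finite, so by the balance a finite outflow forces a finite inflow, and then
subtraction is legitimate. -/
theorem forward_equation_of_expectedOutflow_lt_top (x : S) (t : ℝ≥0) {Γ : Set S}
    (hΓ : MeasurableSet Γ) (hout : π.expectedOutflow x t Γ < ⊤) :
    π.expectedInflow x t Γ < ⊤ ∧ π.expectedOutflow x t Γ < ⊤ ∧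
      (π.lawAt x).real {ω | xi t ω ∈ Sum.inl '' Γ} =
        Γ.indicator 1 x + (π.expectedInflow x t Γ).toReal -
          (π.expectedOutflow x t Γ).toReal := by
  have h := π.lawAt_add_expectedOutflow x t hΓ
  have h1 : π.lawAt x {ω | xi t ω ∈ Sum.inl '' Γ} ≠ ⊤ := measure_ne_top _ _
  have hin : π.expectedInflow x t Γ < ⊤ := by
    refine lt_of_le_of_lt (le_add_self.trans h.symm.le) ?_
    exact ENNReal.add_lt_top.2 ⟨h1.lt_top, hout⟩
  refine ⟨hin, hout, ?_⟩
  have h2 : Γ.indicator (1 : S → ℝ≥0∞) x ≠ ⊤ := by by_cases hx : x ∈ Γ <;> simp [hx]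
  have h3 := congrArg ENNReal.toReal h
  rw [ENNReal.toReal_add h1 hout.ne, ENNReal.toReal_add h2 hin.ne] at h3
  have h4 : (Γ.indicator (1 : S → ℝ≥0∞) x).toReal = Γ.indicator (1 : S → ℝ) x := by
    by_cases hx : x ∈ Γ <;> simp [hx]
  rw [h4] at h3
  rw [measureReal_def]
  linarith

end Policy

/-! ### A Grönwall inequality in `[0,∞]` -/

/-- The exponent `2 * r + 1` makes `r / (2 * r + 1)` at most `1 / 2`, and the summand `1` keeps it
positive when `r = 0`. -/
theorem setLIntegral_exp_le {r : ℝ} (hr : 0 ≤ r) {t : ℝ} (ht : 0 ≤ t) :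
    ENNReal.ofReal r * ∫⁻ u in Ioc 0 t, ENNReal.ofReal (Real.exp ((2 * r + 1) * u)) ≤
      ENNReal.ofReal (Real.exp ((2 * r + 1) * t)) / 2 := by
  have hl : 0 < 2 * r + 1 := by linarith
  have h1 : ∫ u in (0 : ℝ)..t, Real.exp ((2 * r + 1) * u) =
      (Real.exp ((2 * r + 1) * t) - 1) / (2 * r + 1) := by
    rw [intervalIntegral.integral_comp_mul_left (fun u => Real.exp u) hl.ne', integral_exp]
    simp [div_eq_inv_mul]
  have hi : IntegrableOn (fun u => Real.exp ((2 * r + 1) * u)) (Ioc 0 t) :=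
    (Continuous.integrableOn_Icc (by fun_prop)).mono_set Ioc_subset_Icc_self
  rw [← ofReal_integral_eq_lintegral_ofReal hi (ae_of_all _ fun u => (Real.exp_pos _).le),
    ← intervalIntegral.integral_of_le ht, h1, ← ENNReal.ofReal_mul hr,
    ← ENNReal.ofReal_ofNat 2, ← ENNReal.ofReal_div_of_pos two_pos]
  refine ENNReal.ofReal_le_ofReal ?_
  have he := Real.exp_pos ((2 * r + 1) * t)
  rw [← mul_div_assoc, div_le_div_iff₀ hl two_pos]
  nlinarith

/-- Grönwall's inequality for bounded functions, with a non-optimal constant. -/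
theorem le_of_le_add_setLIntegral {g : ℝ≥0 → ℝ≥0∞} {B C : ℝ≥0∞} (hB : B ≠ ⊤) {r : ℝ}
    (hr : 0 ≤ r) (hgB : ∀ t, g t ≤ B)
    (hg : ∀ t : ℝ≥0, g t ≤ C + ENNReal.ofReal r * ∫⁻ u in Ioc (0 : ℝ) t, g u.toNNReal)
    (t : ℝ≥0) : g t ≤ 2 * C * ENNReal.ofReal (Real.exp ((2 * r + 1) * t)) := by
  set e : ℝ≥0 → ℝ≥0∞ := fun t => ENNReal.ofReal (Real.exp ((2 * r + 1) * t)) with he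
  have he0 : ∀ t, e t ≠ 0 := fun t => by simp [he, Real.exp_pos]
  have het : ∀ t, e t ≠ ⊤ := fun t => ENNReal.ofReal_ne_top
  have he1 : ∀ t, 1 ≤ e t := fun t => by
    rw [he, ← ENNReal.ofReal_one]
    exact ENNReal.ofReal_le_ofReal (Real.one_le_exp (by positivity))
  -- In the supremum norm weighted by `1 / e`, the integral operator has norm at most `1 / 2`.
  set m : ℝ≥0∞ := ⨆ t, g t / e t with hm
  have hgm : ∀ t, g t ≤ m * e t := fun t =>
    (ENNReal.div_le_iff (he0 t) (het t)).1 (le_iSup (fun t => g t / e t) t)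
  have hmB : m ≤ B := iSup_le fun t => by
    rw [ENNReal.div_le_iff (he0 t) (het t)]
    exact (hgB t).trans (le_mul_of_one_le_right' (he1 t))
  have hmt : m ≠ ⊤ := ne_top_of_le_ne_top hB hmB
  have hstep : ∀ t, g t ≤ (C + m / 2) * e t := fun t => by
    have h1 : ∫⁻ u in Ioc (0 : ℝ) t, g u.toNNReal ≤
        m * ∫⁻ u in Ioc (0 : ℝ) t, ENNReal.ofReal (Real.exp ((2 * r + 1) * u)) := by
      rw [← lintegral_const_mul' _ _ hmt]
      refine setLIntegral_mono' measurableSet_Ioc fun u hu => (hgm _).trans (le_of_eq ?_)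
      rw [he]
      simp only [Real.coe_toNNReal u hu.1.le]
    calc g t ≤ C + ENNReal.ofReal r * ∫⁻ u in Ioc (0 : ℝ) t, g u.toNNReal := hg t
      _ ≤ C * e t + m * (e t / 2) := by
        refine add_le_add (le_mul_of_one_le_right' (he1 t)) ?_
        refine (mul_le_mul_right h1 _).trans ?_
        rw [mul_left_comm]
        exact mul_le_mul_right (setLIntegral_exp_le hr t.2) _
      _ = (C + m / 2) * e t := by
        rw [add_mul, ENNReal.div_eq_inv_mul, ENNReal.div_eq_inv_mul]; ring
  have hmC : m ≤ C + m / 2 := iSup_le fun t => (ENNReal.div_le_iff (he0 t) (het t)).2 (hstep t)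
  -- Absorbing `m / 2` needs `m` finite; this is where the a priori bound `B` enters.
  have hm2 : m / 2 ≤ C := by
    have h2 : m / 2 ≠ ⊤ := ENNReal.div_ne_top hmt two_ne_zero
    have h3 : m / 2 + m / 2 ≤ C + m / 2 := by rw [ENNReal.add_halves]; exact hmC
    exact (ENNReal.add_le_add_iff_right h2).1 h3
  refine (hgm t).trans (mul_le_mul_left ?_ _)
  rw [← ENNReal.add_halves m, two_mul]
  exact add_le_add hm2 hm2

/-! ### The drift inequality for the jump rate and for truncated weights -/

namespace CTMDP

variable (M : CTMDP S A) [MeasurableSingletonClass S]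

theorem jumpRate_eq_zero {x : S} {a : A} (ha : a ∉ M.adm x) : M.jumpRate x a = 0 := by
  ext Γ hΓ
  simp [M.jumpRate_apply x a hΓ, M.q_off_graph x a ha]

theorem jumpRate_univ {x : S} {a : A} : M.jumpRate x a univ = ENNReal.ofReal (M.exitRate x a) :=
  (M.exitRateExt_eq (Sum.inl x) (Sum.inl a)).symm

theorem exitRate_nonneg {x : S} {a : A} (ha : a ∈ M.adm x) : 0 ≤ M.exitRate x a := by
  have h1 := VectorMeasure.of_sdiff (v := M.q x a) (measurableSet_singleton x)
    MeasurableSet.univ (subset_univ _)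
  rw [M.q_conservative x a ha, zero_sub] at h1
  rw [exitRate, ← h1]
  exact M.q_nonneg x a ha _ (MeasurableSet.univ.diff (measurableSet_singleton x)) (by simp)

/-- The decomposition that turns a drift condition on the signed rate into a bound on the positive
jump rate. -/
theorem toSignedMeasure_jumpRate {x : S} {a : A} (ha : a ∈ M.adm x) :
    M.q x a = (M.jumpRate x a).toSignedMeasure - VectorMeasure.dirac x (M.exitRate x a) := by
  ext Γ hΓ
  have h0 : 0 ≤ M.q x a (Γ \ {x}) :=
    M.q_nonneg x a ha _ (hΓ.diff (measurableSet_singleton x)) (by simp)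
  rw [sub_apply, Measure.toSignedMeasure_apply_measurable hΓ, measureReal_def,
    M.jumpRate_apply x a hΓ, ENNReal.toReal_ofReal h0]
  by_cases hx : x ∈ Γ
  · rw [VectorMeasure.dirac_apply_of_mem hΓ hx, VectorMeasure.of_sdiff
      (measurableSet_singleton x) hΓ (singleton_subset_iff.2 hx), exitRate]
    ring
  · rw [VectorMeasure.dirac_apply_of_notMem hx, sdiff_singleton_eq_self hx, sub_zero]

theorem jumpRate_le_variation (x : S) (a : A) : M.jumpRate x a ≤ (M.q x a).variation := by
  refine Measure.le_iff.2 fun Γ hΓ => ?_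
  rw [M.jumpRate_apply x a hΓ]
  refine (Real.ofReal_le_enorm _).trans ?_
  exact (VectorMeasure.enorm_measure_le_variation _ _).trans (measure_mono sdiff_subset)

/-- The integral of `w` against `q(dy|x,a)` is its integral against the jump rate minus `w(x)
q_x(a)`. Moving the last term across leaves `ρ w(x) + b`, and `w ≥ 1` bounds this by `(ρ + b) w(x)`,
a form without additive constant. -/
theorem lintegral_jumpRate_le {w : S → ℝ} {Sl : ℕ → Set S} {ρ b : ℝ}
    (hw : IsLyapunov M w Sl ρ b) (x : S) (a : A) :
    ∫⁻ y, ENNReal.ofReal (w y) ∂M.jumpRate x a ≤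
      ENNReal.ofReal (ρ + b) * ENNReal.ofReal (w x) +
        ENNReal.ofReal (w x) * M.jumpRate x a univ := by
  by_cases ha : a ∈ M.adm x
  · have hw0 : ∀ y, 0 ≤ w y := fun y => zero_le_one.trans (hw.one_le_weight y)
    have hiq := hw.integrable_weight x a ha
    have hij : Integrable w (M.jumpRate x a) :=
      Integrable.mono_measure hiq (M.jumpRate_le_variation x a)
    have hd := hw.drift x a ha
    rw [M.toSignedMeasure_jumpRate ha, VectorMeasure.integral_sub_vectorMeasure,
      VectorMeasure.integral_dirac] at hd
    -- The integral against a signed measure uses a bilinear pairing; over `ℝ` multiplication is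
    -- symmetric, so it may be flipped to match `integral_toSignedMeasure`.
    · have hflip : ContinuousLinearMap.lsmul ℝ ℝ (E := ℝ) =
          (ContinuousLinearMap.lsmul ℝ ℝ (E := ℝ)).flip := by
        ext; simp
      rw [hflip, VectorMeasure.integral_toSignedMeasure] at hd
      simp only [ContinuousLinearMap.flip_apply, ContinuousLinearMap.lsmul_apply,
        smul_eq_mul] at hd
      rw [← ofReal_integral_eq_lintegral_ofReal hij (ae_of_all _ hw0), M.jumpRate_univ,
        ← ENNReal.ofReal_mul (add_nonneg hw.rho_nonneg hw.b_nonneg),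
        ← ENNReal.ofReal_mul (hw0 x), ← ENNReal.ofReal_add
          (mul_nonneg (add_nonneg hw.rho_nonneg hw.b_nonneg) (hw0 x))
          (mul_nonneg (hw0 x) (M.exitRate_nonneg ha))]
      refine ENNReal.ofReal_le_ofReal ?_
      nlinarith [hw.one_le_weight x, hw.b_nonneg]
    · rw [VectorMeasure.Integrable, Measure.variation_toSignedMeasure]
      exact hij
    · rw [VectorMeasure.Integrable, VectorMeasure.variation_dirac]
      exact (integrable_dirac (by simp)).smul_measure (by simp)
  · simp [M.jumpRate_eq_zero ha]

end CTMDP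

/-- The weight function `w`, truncated at level `l`. -/
def cappedWeight (w : S → ℝ) (l : ℕ) (y : S) : ℝ≥0∞ := min (ENNReal.ofReal (w y)) l

theorem measurable_cappedWeight {w : S → ℝ} (hw : Measurable w) (l : ℕ) :
    Measurable (cappedWeight w l) :=
  hw.ennreal_ofReal.min measurable_const

/-- Truncation preserves the inequality. Where `w(x) ≤ l` the truncated integral is at most the full
one; where `w(x) ≥ l` the integrand never exceeds its value `l` at `x`, so the second term alone
suffices. -/
theorem CTMDP.lintegral_cappedWeight_le [MeasurableSingletonClass S] (M : CTMDP S A) {w : S → ℝ}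
    {Sl : ℕ → Set S} {ρ b : ℝ} (hw : IsLyapunov M w Sl ρ b) (l : ℕ) (x : WithCemetery S)
    (a : WithCemetery A) :
    ∫⁻ y, cappedWeight w l y ∂M.jumpRateExt x a ≤
      ENNReal.ofReal (ρ + b) * Sum.elim (cappedWeight w l) 0 x +
        Sum.elim (cappedWeight w l) 0 x * M.jumpRateExt x a univ := by
  rcases x with x | x
  · rcases a with a | a
    · change ∫⁻ y, cappedWeight w l y ∂M.jumpRate x a ≤ ENNReal.ofReal (ρ + b) *
        cappedWeight w l x + cappedWeight w l x * M.jumpRate x a univ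
      rcases le_total (ENNReal.ofReal (w x)) l with h | h
      · rw [cappedWeight, min_eq_left h]
        exact (lintegral_mono fun y => min_le_left _ _).trans (M.lintegral_jumpRate_le hw x a)
      · rw [cappedWeight, min_eq_right h]
        refine (lintegral_mono fun y => min_le_right _ _).trans ?_
        rw [lintegral_const]
        exact le_add_self
    · simp [CTMDP.jumpRateExt]
  · simp [CTMDP.jumpRateExt]

/-! ### The bound on the expected weight -/

namespace Policy

variable {M : CTMDP S A} (π : Policy M) [StandardBorelSpace S] {f : S → ℝ≥0∞}

theorem lintegral_intensity_cappedWeight_le {w : S → ℝ} {Sl : ℕ → Set S} {ρ b : ℝ}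
    (hw : IsLyapunov M w Sl ρ b) (l k : ℕ) (h : Hist S k) (u : ℝ) :
    ∫⁻ y, cappedWeight w l y ∂π.intensity k h u ≤
      ENNReal.ofReal (ρ + b) * Sum.elim (cappedWeight w l) 0 (lastState k h) +
        Sum.elim (cappedWeight w l) 0 (lastState k h) * π.intensity k h u univ := by
  have hm : Measurable fun a => M.jumpRateExt (lastState k h) a :=
    M.measurable_jumpRateExt.comp measurable_prodMk_left
  have hmu : Measurable fun a => M.jumpRateExt (lastState k h) a univ :=
    (Measure.measurable_coe MeasurableSet.univ).comp hm
  rw [intensity, Measure.lintegral_bind hm.aemeasurable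
    (measurable_cappedWeight hw.measurable_weight l).aemeasurable,
    Measure.bind_apply MeasurableSet.univ hm.aemeasurable]
  refine (lintegral_mono fun a => M.lintegral_cappedWeight_le hw l _ a).trans ?_
  rw [lintegral_add_left measurable_const, lintegral_const, measure_univ, mul_one,
    lintegral_const_mul _ hmu]

/-- Along a path, the rate at which weight arrives exceeds the rate at which it departs by at most
`ρ + b` times the present weight. -/
theorem jumpDensity_cappedWeight_le {w : S → ℝ} {Sl : ℕ → Set S} {ρ b : ℝ}
    (hw : IsLyapunov M w Sl ρ b) (l k : ℕ) (s : ℕ → Step S) (u : ℝ) :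
    π.jumpDensity k (fun _ => 1) (cappedWeight w l) s u ≤
      ENNReal.ofReal (ρ + b) * (Ico (jumpTime s k) (jumpTime s (k + 1))).indicator
        (fun _ => Sum.elim (cappedWeight w l) 0 (s k).2) (ENNReal.ofReal u) +
      π.jumpDensity k (fun h => Sum.elim (cappedWeight w l) 0 (lastState k h))
        (fun _ => 1) s u := by
  by_cases hu : ENNReal.ofReal u ∈ sojourn s k
  · have hu' : ENNReal.ofReal u ∈ Ico (jumpTime s k) (jumpTime s (k + 1)) := ⟨hu.1.le, hu.2⟩
    rw [jumpDensity, jumpDensity, indicator_of_mem hu, indicator_of_mem hu, indicator_of_mem hu',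
      one_mul, lintegral_one]
    exact π.lintegral_intensity_cappedWeight_le hw l k _ _
  · rw [jumpDensity, indicator_of_notMem hu]
    exact bot_le

omit [StandardBorelSpace S] in
theorem measurable_indicator_Ico (hf : Measurable f) (k : ℕ) :
    Measurable fun p : (ℕ → Step S) × ℝ => (Ico (jumpTime p.1 k) (jumpTime p.1 (k + 1))).indicator
      (fun _ => (Sum.elim f 0 : WithCemetery S → ℝ≥0∞) (p.1 k).2) (ENNReal.ofReal p.2) := by
  have h1 : ∀ m, Measurable fun p : (ℕ → Step S) × ℝ => jumpTime p.1 m :=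
    fun m => (measurable_jumpTime m).comp measurable_fst
  have h2 : Measurable fun p : (ℕ → Step S) × ℝ => ENNReal.ofReal p.2 :=
    measurable_snd.ennreal_ofReal
  exact ((measurable_elim_state hf k).comp measurable_fst).indicator
    ((measurableSet_le (h1 k) h2).inter (measurableSet_lt h2 (h1 (k + 1))))

theorem expectedIn_cappedWeight_le {w : S → ℝ} {Sl : ℕ → Set S} {ρ b : ℝ}
    (hw : IsLyapunov M w Sl ρ b) (x : S) (t : ℝ≥0) (l k : ℕ) :
    π.expectedIn x t (cappedWeight w l) k ≤
      ENNReal.ofReal (ρ + b) *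
        (∫⁻ u in Ioc (0 : ℝ) t, π.expectedStay x u.toNNReal (cappedWeight w l) k) +
      π.expectedOut x t (cappedWeight w l) k := by
  have hf := measurable_cappedWeight hw.measurable_weight l
  have hm := measurable_indicator_Ico hf k
  have hm' : Measurable fun u : ℝ => π.expectedStay x u.toNNReal (cappedWeight w l) k :=
    Measurable.lintegral_prod_left' hm
  rw [← lintegral_const_mul _ hm', expectedOut, ← lintegral_add_left (hm'.const_mul _)]
  refine lintegral_mono fun u => ?_
  have hmu : Measurable fun s : ℕ → Step S =>
      (Ico (jumpTime s k) (jumpTime s (k + 1))).indicator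
        (fun _ => (Sum.elim (cappedWeight w l) 0 : WithCemetery S → ℝ≥0∞) (s k).2)
        (ENNReal.ofReal u) :=
    hm.comp measurable_prodMk_right
  refine (lintegral_mono fun s => π.jumpDensity_cappedWeight_le hw l k s u).trans ?_
  rw [lintegral_add_left (hmu.const_mul _), lintegral_const_mul _ hmu]
  rfl

theorem expectedHits_le (x : S) (t : ℝ≥0) {C : ℝ≥0∞} (hf : ∀ y, f y ≤ C) (k : ℕ) :
    π.expectedHits x t f k ≤ C := by
  refine (lintegral_mono (g := fun _ => C) fun s => ?_).trans (by simp)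
  refine (indicator_le_self' (fun _ _ => bot_le) s).trans ?_
  rcases (s k).2 with y | y
  · exact hf y
  · exact bot_le

/-- The balance over the first `n` sojourns, with the inflow replaced by its drift bound; the
outflow then occurs on both sides and cancels. -/
theorem sum_expectedStay_cappedWeight_le_add {w : S → ℝ} {Sl : ℕ → Set S} {ρ b : ℝ}
    (hw : IsLyapunov M w Sl ρ b) (x : S) (t : ℝ≥0) (l n : ℕ) :
    ∑ k ∈ Finset.range n, π.expectedStay x t (cappedWeight w l) k ≤
      ENNReal.ofReal (w x) + ENNReal.ofReal (ρ + b) * ∫⁻ u in Ioc (0 : ℝ) t,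
        ∑ k ∈ Finset.range n, π.expectedStay x u.toNNReal (cappedWeight w l) k := by
  have hf := measurable_cappedWeight hw.measurable_weight l
  have hhits : ∀ k, π.expectedHits x t (cappedWeight w l) k ≤ l :=
    fun k => π.expectedHits_le x t (fun y => min_le_right _ _) k
  -- Each outflow term is at most the corresponding hits term, hence at most `l`. Truncation and
  -- finite sums are there to make this cancellation possible.
  have hout : ∑ k ∈ Finset.range n, π.expectedOut x t (cappedWeight w l) k ≠ ⊤ := by
    refine ENNReal.sum_ne_top.2 fun k _ => ne_top_of_le_ne_top (ENNReal.natCast_ne_top l) ?_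
    refine le_trans ?_ (hhits k)
    rw [π.expectedHits_eq x t hf k]
    exact le_add_self
  refine (ENNReal.add_le_add_iff_right hout).1 ?_
  rw [← Finset.sum_add_distrib, ← Finset.sum_congr rfl fun k _ => π.expectedHits_eq x t hf k]
  have h1 : ∑ k ∈ Finset.range n, π.expectedHits x t (cappedWeight w l) k ≤
      ENNReal.ofReal (w x) + ∑ k ∈ Finset.range n, π.expectedIn x t (cappedWeight w l) k := by
    -- One extra hits term is added so that, after the initial one is split off, exactly `n` remain,
    -- matching the `n` inflow terms.
    refine (Finset.sum_le_sum_of_subset (Finset.range_mono n.le_succ)).trans ?_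
    rw [Finset.sum_range_succ', add_comm, expectedHits_zero]
    refine add_le_add (min_le_left _ _) (le_of_eq ?_)
    exact Finset.sum_congr rfl fun k _ => π.expectedHits_succ x t hf k
  refine h1.trans ?_
  rw [add_assoc]
  refine add_le_add_right ?_ _
  have hm : ∀ k, Measurable fun u : ℝ => π.expectedStay x u.toNNReal (cappedWeight w l) k :=
    fun k => Measurable.lintegral_prod_left' (measurable_indicator_Ico hf k)
  rw [lintegral_finsetSum _ fun k _ => hm k, Finset.mul_sum, ← Finset.sum_add_distrib]
  exact Finset.sum_le_sum fun k _ => π.expectedIn_cappedWeight_le hw x t l k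

/-- The crude bound `n * l` serves only as the a priori bound in Grönwall's inequality; the
conclusion depends on neither `n` nor `l`. -/
theorem sum_expectedStay_cappedWeight_le {w : S → ℝ} {Sl : ℕ → Set S} {ρ b : ℝ}
    (hw : IsLyapunov M w Sl ρ b) (x : S) (t : ℝ≥0) (l n : ℕ) :
    ∑ k ∈ Finset.range n, π.expectedStay x t (cappedWeight w l) k ≤
      2 * ENNReal.ofReal (w x) * ENNReal.ofReal (Real.exp ((2 * (ρ + b) + 1) * t)) := by
  have hf := measurable_cappedWeight hw.measurable_weight l
  refine le_of_le_add_setLIntegral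
    (g := fun t => ∑ k ∈ Finset.range n, π.expectedStay x t (cappedWeight w l) k)
    (B := n * l) (ENNReal.mul_ne_top (ENNReal.natCast_ne_top n) (ENNReal.natCast_ne_top l))
    (add_nonneg hw.rho_nonneg hw.b_nonneg) (fun t => ?_)
    (fun t => π.sum_expectedStay_cappedWeight_le_add hw x t l n) t
  refine (Finset.sum_le_card_nsmul _ _ (l : ℝ≥0∞) fun k _ => ?_).trans (by simp)
  refine le_trans ?_ (π.expectedHits_le x t (f := cappedWeight w l) (fun y => min_le_right _ _) k)
  rw [π.expectedHits_eq x t hf k]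
  exact le_self_add

/-- The Lyapunov bound on the expected weight of the state at time `t`. -/
theorem tsum_expectedStay_weight_le {w : S → ℝ} {Sl : ℕ → Set S} {ρ b : ℝ}
    (hw : IsLyapunov M w Sl ρ b) (x : S) (t : ℝ≥0) :
    ∑' k, π.expectedStay x t (fun y => ENNReal.ofReal (w y)) k ≤
      2 * ENNReal.ofReal (w x) * ENNReal.ofReal (Real.exp ((2 * (ρ + b) + 1) * t)) := by
  refine ENNReal.tsum_le_of_sum_range_le fun n => ?_
  -- For fixed `n` let `l → ∞`: the truncated weights increase to `w`, so each term converges by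
  -- monotone convergence.
  refine le_of_tendsto' (f := fun l => ∑ k ∈ Finset.range n,
    π.expectedStay x t (cappedWeight w l) k) (x := atTop) (tendsto_finsetSum _ fun k _ => ?_)
    fun l => π.sum_expectedStay_cappedWeight_le hw x t l n
  have hmono : Monotone fun (l : ℕ) (y : S) => cappedWeight w l y := fun l l' h y =>
    min_le_min le_rfl (by exact_mod_cast h)
  have hlim : ∀ y, Tendsto (fun l => cappedWeight w l y) atTop (𝓝 (ENNReal.ofReal (w y))) := by
    intro y
    obtain ⟨l₀, hl₀⟩ := exists_nat_ge (w y)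
    refine tendsto_atTop_of_eventually_const (i₀ := l₀) fun l hl => min_eq_left ?_
    rw [← ENNReal.ofReal_natCast]
    exact ENNReal.ofReal_le_ofReal (hl₀.trans (by exact_mod_cast hl))
  refine lintegral_tendsto_of_tendsto_of_monotone (fun l => ?_) (ae_of_all _ fun s l l' h => ?_)
    (ae_of_all _ fun s => ?_)
  · have := (measurable_indicator_Ico (measurable_cappedWeight hw.measurable_weight l) k).comp
      (measurable_prodMk_right (y := (t : ℝ)))
    simp only [Function.comp_def, ENNReal.ofReal_coe_nnreal] at this
    exact this.aemeasurable
  · refine indicator_le_indicator ?_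
    rcases (s k).2 with y | y
    · exact hmono h y
    · exact le_rfl
  · by_cases hs : (t : ℝ≥0∞) ∈ Ico (jumpTime s k) (jumpTime s (k + 1))
    · simp only [indicator_of_mem hs]
      rcases (s k).2 with y | y
      · exact hlim y
      · exact tendsto_const_nhds
    · simp only [indicator_of_notMem hs]
      exact tendsto_const_nhds

/-! ### Finiteness of the outflow -/

omit [StandardBorelSpace S] in
theorem exitRateExt_le [MeasurableSingletonClass S] (y : S) (a : WithCemetery A) :
    M.exitRateExt (Sum.inl y) a ≤ ENNReal.ofReal (M.maxExitRate y) := by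
  rcases a with a | a
  · rw [M.exitRateExt_eq]
    exact M.jumpRate_univ_le y a
  · exact bot_le

/-- A bound on the outflow by the expected occupation integral of a bound on the exit rate. -/
theorem expectedOutflow_le (x : S) (t : ℝ≥0) {Γ : Set S}
    (hf : ∀ y ∈ Γ, ENNReal.ofReal (M.maxExitRate y) ≤ f y) :
    π.expectedOutflow x t Γ ≤
      ∫⁻ ω, ∫⁻ u in Ioc (0 : ℝ) t, Sum.elim f 0 (xi u.toNNReal ω) ∂volume ∂π.lawAt x := by
  refine lintegral_mono fun ω => lintegral_mono fun u => ?_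
  refine (lintegral_mono (g := fun _ => Sum.elim f 0 (xi u.toNNReal ω)) fun a => ?_).trans
    (by rw [lintegral_const, π.act_prob, mul_one])
  rw [indicator_inl_image]
  rcases xi u.toNNReal ω with y | y
  · by_cases hy : y ∈ Γ
    · simpa [hy] using (exitRateExt_le y a).trans (hf y hy)
    · simp [hy]
  · simp

/-- Links the occupation integral of `ξ` with the sums bounded by Grönwall's inequality: split by
sojourns, then exchange expectation and time by Tonelli. -/
theorem lintegral_xi_eq (x : S) (t : ℝ≥0) (hf : Measurable f) :
    ∫⁻ ω, ∫⁻ u in Ioc (0 : ℝ) t, Sum.elim f 0 (xi u.toNNReal ω) ∂volume ∂π.lawAt x =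
      ∫⁻ u in Ioc (0 : ℝ) t, ∑' k, π.expectedStay x u.toNNReal f k := by
  have hm : Measurable fun p : (ℕ → Step S) × ℝ =>
      ∑' k, (Ico (jumpTime p.1 k) (jumpTime p.1 (k + 1))).indicator
        (fun _ => (Sum.elim f 0 : WithCemetery S → ℝ≥0∞) (p.1 k).2) (ENNReal.ofReal p.2) :=
    Measurable.tsum fun k => measurable_indicator_Ico hf k
  have h1 : ∀ (ω : Path S) (u : ℝ), Sum.elim f 0 (xi u.toNNReal ω) =
      ∑' k, (Ico (jumpTime ω.1 k) (jumpTime ω.1 (k + 1))).indicator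
        (fun _ => (Sum.elim f 0 : WithCemetery S → ℝ≥0∞) (ω.1 k).2) (ENNReal.ofReal u) :=
    fun ω u => eq_tsum_indicator_Ico rfl u.toNNReal ω
  simp_rw [h1]
  rw [π.lintegral_lawAt x (Measurable.lintegral_prod_right' hm),
    lintegral_lintegral_swap hm.aemeasurable]
  refine lintegral_congr fun u => lintegral_tsum fun k => ?_
  exact ((measurable_indicator_Ico hf k).comp measurable_prodMk_right).aemeasurable

theorem expectedOutflow_lt_top_of_bddAbove (x : S) (t : ℝ≥0) {Γ : Set S}
    (hΓ : BddAbove (M.maxExitRate '' Γ)) : π.expectedOutflow x t Γ < ⊤ := by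
  obtain ⟨C, hC⟩ := hΓ
  refine (π.expectedOutflow_le x t (f := fun _ => ENNReal.ofReal C) fun y hy =>
    ENNReal.ofReal_le_ofReal (hC ⟨y, hy, rfl⟩)).trans_lt ?_
  refine (lintegral_mono (g := fun _ => ENNReal.ofReal C * ENNReal.ofReal t) fun ω => ?_).trans_lt
    (by simp [ENNReal.mul_lt_top])
  refine (lintegral_mono (g := fun _ => ENNReal.ofReal C) fun u => ?_).trans (by simp)
  rcases xi u.toNNReal ω with y | y
  · exact le_rfl
  · exact bot_le

/-- The outflow is at most `L` times the time integral of the expected weight, which stays below a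
constant on `[0,t]`. -/
theorem expectedOutflow_lt_top_of_lt_weight {w : S → ℝ} {Sl : ℕ → Set S} {ρ b L : ℝ}
    (hw : IsLyapunov M w Sl ρ b) (hL : 0 < L) (hLw : ∀ y, M.maxExitRate y < L * w y)
    (x : S) (t : ℝ≥0) (Γ : Set S) : π.expectedOutflow x t Γ < ⊤ := by
  have hWm : Measurable fun y => ENNReal.ofReal (w y) := hw.measurable_weight.ennreal_ofReal
  set W : S → ℝ≥0∞ := fun y => ENNReal.ofReal (w y) with hW
  set K : ℝ≥0∞ := 2 * ENNReal.ofReal (w x) *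
    ENNReal.ofReal (Real.exp ((2 * (ρ + b) + 1) * t)) with hK
  have hKtop : K < ⊤ := ENNReal.mul_lt_top
    (ENNReal.mul_lt_top ENNReal.ofNat_lt_top ENNReal.ofReal_lt_top) ENNReal.ofReal_lt_top
  have h1 : ∫⁻ u in Ioc (0 : ℝ) t, ∑' k, π.expectedStay x u.toNNReal W k ≤
      K * ENNReal.ofReal t := by
    refine (setLIntegral_mono' (g := fun _ => K) measurableSet_Ioc fun u hu => ?_).trans (by simp)
    refine (π.tsum_expectedStay_weight_le hw x u.toNNReal).trans ?_
    -- The exponential bound increases in time, so its value `K` at `t` serves for all `u ≤ t`.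
    refine mul_le_mul_right (ENNReal.ofReal_le_ofReal (Real.exp_le_exp.2 ?_)) _
    rw [Real.coe_toNNReal u hu.1.le]
    exact mul_le_mul_of_nonneg_left hu.2 (by linarith [hw.rho_nonneg, hw.b_nonneg])
  refine (π.expectedOutflow_le x t (f := fun y => ENNReal.ofReal L * W y) fun y _ => ?_).trans_lt ?_
  · rw [hW, ← ENNReal.ofReal_mul hL.le]
    exact ENNReal.ofReal_le_ofReal (hLw y).le
  · have h2 : ∀ z : WithCemetery S, Sum.elim (fun y => ENNReal.ofReal L * W y) 0 z =
        ENNReal.ofReal L * Sum.elim W 0 z := fun z => by rcases z with z | z <;> simp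
    simp_rw [h2, lintegral_const_mul' _ _ ENNReal.ofReal_ne_top]
    rw [π.lintegral_xi_eq x t hWm]
    exact ENNReal.mul_lt_top ENNReal.ofReal_lt_top
      (h1.trans_lt (ENNReal.mul_lt_top hKtop ENNReal.ofReal_lt_top))

end Policy

end KitaevCTMDP

end

open KitaevCTMDP

theorem mainTheorem5 {S A : Type*} [MeasurableSpace S] [StandardBorelSpace S]
    [MeasurableSpace A] [StandardBorelSpace A]
    (M : CTMDP S A) (π : Policy M) (w : S → ℝ) (Sl : ℕ → Set S) (ρ b : ℝ)
    (hw : IsLyapunov M w Sl ρ b) :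
    ((∀ l, BddAbove (M.maxExitRate '' Sl l)) →
      ∀ (x : S) (t : ℝ≥0) (Γ : Set S), MeasurableSet Γ → (∃ l, Γ ⊆ Sl l) →
        π.expectedInflow x t Γ < ⊤ ∧ π.expectedOutflow x t Γ < ⊤ ∧
        (π.lawAt x).real {ω | xi t ω ∈ Sum.inl '' Γ} =
          Γ.indicator 1 x + (π.expectedInflow x t Γ).toReal -
            (π.expectedOutflow x t Γ).toReal) ∧
    ((∃ L > 0, ∀ x, M.maxExitRate x < L * w x) →
      ∀ (x : S) (t : ℝ≥0) (Γ : Set S), MeasurableSet Γ →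
        π.expectedInflow x t Γ < ⊤ ∧ π.expectedOutflow x t Γ < ⊤ ∧
        (π.lawAt x).real {ω | xi t ω ∈ Sum.inl '' Γ} =
          Γ.indicator 1 x + (π.expectedInflow x t Γ).toReal -
            (π.expectedOutflow x t Γ).toReal) := by
  refine ⟨fun hq x t Γ hΓ ⟨l, hl⟩ => ?_, fun ⟨L, hL, hLw⟩ x t Γ hΓ => ?_⟩
  · exact π.forward_equation_of_expectedOutflow_lt_top x t hΓ
      (π.expectedOutflow_lt_top_of_bddAbove x t ((hq l).mono (image_mono hl)))
  · exact π.forward_equation_of_expectedOutflow_lt_top x t hΓ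
      (π.expectedOutflow_lt_top_of_lt_weight hw hL hLw x t Γ)
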